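/- Let $n\ge 3$. Let $\mathfrak g=\mathfrak g_n^{\mathbb C}=\mathfrak o(n,\mathbb C)\ltimes\mathfrak h_n^{\mathbb C}$ be the complex Lie algebra with basis $\mathbf l_{ij}$ ($1\le i<j\le n$; put $\mathbf l_{ji}=-\mathbf l_{ij}$, $\mathbf l_{ii}=0$), $\mathbf e_1,\dots,\mathbf e_{2n}$, $\mathbf I$. Here $\mathfrak o(n,\mathbb C)$ consists of the skew-symmetric matrices, $\mathbf l_{ij}=E_{ji}-E_{ij}$, acting in the standard way on $\mathrm{span}(\mathbf e_1,\dots,\mathbf e_n)$ and on $\mathrm{span}(\mathbf e_{n+1},\dots,\mathbf e_{2n})$ and trivially on $\mathbf I$. The brackets of the Heisenberg algebra $\mathfrak h_n^{\mathbb C}$ are $[\mathbf e_i,\mathbf e_{n+j}]=\delta_{ij}\mathbf I$ for $1\le i,j\le n$, the other brackets of $\mathbf e_1,\dots,\mathbf e_{2n},\mathbf I$ being zero. Let $f_1,f_2,f_3:\bigwedge^2\mathfrak g\to\mathfrak g$ be the 2-cochains given, for $1\le i,j\le n$, by $$f_1(\mathbf e_i,\mathbf e_j)=\mathbf l_{ij},\quad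 f_1(\mathbf e_i,\mathbf I)=-\mathbf e_{n+i};\qquad f_2(\mathbf e_{n+i},\mathbf e_{n+j})=\mathbf l_{ij},\quad f_2(\mathbf e_{n+i},\mathbf I)=\mathbf e_i;$$ $$f_3(\mathbf e_i,\mathbf e_{n+j})=\mathbf l_{ij},\quad f_3(\mathbf e_i,\mathbf I)=\mathbf e_i,\quad f_3(\mathbf e_{n+i},\mathbf I)=-\mathbf e_{n+i},$$ and by zero on all other pairs of basis elements, up to antisymmetry. For $\varepsilon=(\varepsilon_1,\varepsilon_2,\varepsilon_3)\in\mathbb C^3$ let $\mathfrak g(\varepsilon)$ be the vector space $\mathfrak g$ with the bracket $$[\cdot,\cdot]_\varepsilon=[\cdot,\cdot]+\varepsilon_1f_1+\varepsilon_2f_2+\varepsilon_3f_3 .$$ Then the following hold. 1. The space $H^2(\mathfrak g,\mathfrak g)$ of infinitesimal deformations (adjoint coefficients) is three-dimensional. The cochains $f_1,f_2,f_3$ are cocycles, and their classes form a basis of it. 2. Every infinitesimal deformation is integrable: for every 2-cocycle $c$ there is a formal deformation $\varphi_t=[\cdot,\cdot]+tc+t^2\varphi_2+\cdots$ of the bracket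 satisfying the Jacobi identity to all orders in $t$. Moreover, for some $\varepsilon\in\mathbb C^3$, it can be chosen equivalent to the family $\mathfrak g(t\varepsilon)$, that is, there are linear maps $T_k:\mathfrak g\to\mathfrak g$ such that $T_t=\mathrm{id}+\sum_{k\ge1}t^kT_k$ satisfies $T_t(\varphi_t(x,y))=[T_tx,T_ty]_{t\varepsilon}$ for all $x,y\in\mathfrak g$, as formal power series in $t$. 3. For every $\varepsilon\in\mathbb C^3$ the bracket $[\cdot,\cdot]_\varepsilon$ satisfies the Jacobi identity, so that $\mathfrak g(\varepsilon)$ is a Lie algebra. The generic one is isomorphic to $\mathfrak o(n+2,\mathbb C)$: this holds whenever $\varepsilon_1\ne0$, $\varepsilon_2\neq 0$ and $\varepsilon_3^2\ne\varepsilon_1\varepsilon_2$. -/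

import Mathlib

open LieModule.Cohomology LieAlgebra.Orthogonal Matrix

namespace HeisDef

section Deformations

variable (R L : Type*) [CommRing R] [LieRing L] [LieAlgebra R L]

instance : AddCommGroup (twoCochain R L L) := (twoCochain R L L).addCommGroup

instance : AddCommGroup (twoCocycle R L L) := (twoCocycle R L L).addCommGroup

/-- The coboundary `d : C¹(L, L) → C²(L, L)` for the adjoint representation, viewed as a linear map
into the 2-cocycles. -/
def coboundaryMap : oneCochain R L L →ₗ[R] twoCocycle R L L :=
  (d₁₂ R L L).codRestrict (twoCocycle R L L) fun f => by
    rw [mem_twoCocycle_iff]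
    exact LinearMap.congr_fun (d₂₃_comp_d₁₂ R L L) f

/-- The second Lie algebra cohomology space `H²(L, L)` with coefficients in the adjoint
representation: 2-cocycles modulo 2-coboundaries. -/
abbrev H2 : Type _ := twoCocycle R L L ⧸ LinearMap.range (coboundaryMap R L)

/-- The cohomology class of a 2-cocycle. -/
abbrev H2.mk : twoCocycle R L L →ₗ[R] H2 R L := Submodule.mkQ _

/-- The Lie bracket of `L` as an alternating bilinear map. -/
def bracketCochain : twoCochain R L L :=
  ⟨LinearMap.mk₂ R (fun x y => ⁅x, y⁆) add_lie smul_lie lie_add (fun c x y => lie_smul c x y),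
    fun x => lie_self x⟩

variable {R L}

/-- The Jacobi identity for an alternating bilinear map on the vector space underlying `L`. -/
def Jacobi (μ : twoCochain R L L) : Prop :=
  ∀ x y z : L, μ (μ x y) z + μ (μ y z) x + μ (μ z x) y = 0

/-- `φ 0 + t φ 1 + t² φ 2 + ⋯` is a formal one-parameter deformation of the Lie bracket of `L`:
the constant term is the bracket of `L`, and the Jacobi identity holds at every order in `t`. -/
def IsFormalDeformation (φ : ℕ → twoCochain R L L) : Prop :=
  φ 0 = bracketCochain R L ∧
    ∀ (k : ℕ) (x y z : L), ∑ ij ∈ Finset.HasAntidiagonal.antidiagonal k,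
      (φ ij.1 (φ ij.2 x y) z + φ ij.1 (φ ij.2 y z) x + φ ij.1 (φ ij.2 z x) y) = 0

/-- Two formal one-parameter families of brackets `φ_t = ∑ tᵏ φ k` and `φ'_t = ∑ tᵏ φ' k` on `L` are
equivalent if there is `T_t = id + t T 1 + t² T 2 + ⋯` with `T_t (φ_t(x, y)) = φ'_t(T_t x, T_t y)` as
formal power series in `t`. -/
def FormallyEquivalent (φ φ' : ℕ → twoCochain R L L) : Prop :=
  ∃ T : ℕ → (L →ₗ[R] L), T 0 = LinearMap.id ∧
    ∀ (k : ℕ) (x y : L),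
      ∑ ij ∈ Finset.HasAntidiagonal.antidiagonal k, T ij.1 (φ ij.2 x y) =
        ∑ ij ∈ Finset.HasAntidiagonal.antidiagonal k,
          ∑ pq ∈ Finset.HasAntidiagonal.antidiagonal ij.2, φ' ij.1 (T pq.1 x) (T pq.2 y)

/-- The vector space underlying `L`, to be equipped with the Lie bracket `μ` in place of that of
`L`. -/
def WithBracket (μ : twoCochain R L L) (_ : Jacobi μ) : Type _ := L

namespace WithBracket

variable (μ : twoCochain R L L) (h : Jacobi μ)

instance : AddCommGroup (WithBracket μ h) := inferInstanceAs (AddCommGroup L)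

instance : Module R (WithBracket μ h) := inferInstanceAs (Module R L)

/-- The identity map. -/
def equiv : WithBracket μ h ≃ₗ[R] L := LinearEquiv.refl R L

instance : Bracket (WithBracket μ h) (WithBracket μ h) where
  bracket x y := (equiv μ h).symm (μ (equiv μ h x) (equiv μ h y))

lemma equiv_lie (x y : WithBracket μ h) :
    equiv μ h ⁅x, y⁆ = μ (equiv μ h x) (equiv μ h y) := rfl

instance : LieRing (WithBracket μ h) where
  add_lie x y z := (equiv μ h).injective (by
    rw [map_add, equiv_lie, equiv_lie, equiv_lie, map_add, map_add, LinearMap.add_apply])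
  lie_add x y z := (equiv μ h).injective (by
    rw [map_add, equiv_lie, equiv_lie, equiv_lie, map_add, map_add])
  lie_self x := (equiv μ h).injective (by
    rw [equiv_lie, map_zero]; exact twoCochain_alt μ _)
  leibniz_lie x y z := (equiv μ h).injective (by
    rw [map_add]
    simp only [equiv_lie]
    have H := h (equiv μ h x) (equiv μ h y) (equiv μ h z)
    rw [← twoCochain_skew μ (equiv μ h x) (μ (equiv μ h y) (equiv μ h z)),
      ← twoCochain_skew μ (equiv μ h y) (μ (equiv μ h z) (equiv μ h x)),
      ← twoCochain_skew μ (equiv μ h x) (equiv μ h z), map_neg, neg_neg] at H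
    rw [← sub_eq_zero, ← neg_eq_zero, ← H]
    abel)

instance : LieAlgebra R (WithBracket μ h) where
  lie_smul c x y := (equiv μ h).injective (by
    rw [map_smul, equiv_lie, equiv_lie, map_smul, map_smul])

end WithBracket

end Deformations

section Heisenberg

variable (R : Type*) [CommRing R] (n : ℕ)

/-- The Heisenberg Lie algebra of dimension `2n + 1`. An element is
`∑ i, x i • e_i + ∑ i, p i • e_{n+i} + z • I`. -/
@[ext] structure Heisenberg where
  /-- the coordinates along `e_1, …, e_n` -/
  x : Fin n → R
  /-- the coordinates along `e_{n+1}, …, e_{2n}` -/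
  p : Fin n → R
  /-- the coordinate along the central element `I` -/
  z : R

namespace Heisenberg

variable {R n}

/-- The coordinates, as a bijection with a product. -/
def toProd : Heisenberg R n ≃ (Fin n → R) × (Fin n → R) × R where
  toFun a := (a.x, a.p, a.z)
  invFun a := ⟨a.1, a.2.1, a.2.2⟩
  left_inv _ := rfl
  right_inv _ := rfl

instance : AddCommGroup (Heisenberg R n) := toProd.addCommGroup

instance : Module R (Heisenberg R n) := toProd.module R

/-- The bracket determined by `⁅e_i, e_{n+j}⁆ = δ_{ij} I`, all other brackets of basis elements
being zero. -/
instance : Bracket (Heisenberg R n) (Heisenberg R n) where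
  bracket a b := ⟨0, 0, a.x ⬝ᵥ b.p - b.x ⬝ᵥ a.p⟩

@[simp] lemma add_x (a b : Heisenberg R n) : (a + b).x = a.x + b.x := rfl
@[simp] lemma add_p (a b : Heisenberg R n) : (a + b).p = a.p + b.p := rfl
@[simp] lemma add_z (a b : Heisenberg R n) : (a + b).z = a.z + b.z := rfl
@[simp] lemma sub_x (a b : Heisenberg R n) : (a - b).x = a.x - b.x := rfl
@[simp] lemma sub_p (a b : Heisenberg R n) : (a - b).p = a.p - b.p := rfl
@[simp] lemma sub_z (a b : Heisenberg R n) : (a - b).z = a.z - b.z := rfl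
@[simp] lemma neg_x (a : Heisenberg R n) : (-a).x = -a.x := rfl
@[simp] lemma neg_p (a : Heisenberg R n) : (-a).p = -a.p := rfl
@[simp] lemma neg_z (a : Heisenberg R n) : (-a).z = -a.z := rfl
@[simp] lemma zero_x : (0 : Heisenberg R n).x = 0 := rfl
@[simp] lemma zero_p : (0 : Heisenberg R n).p = 0 := rfl
@[simp] lemma zero_z : (0 : Heisenberg R n).z = 0 := rfl
@[simp] lemma smul_x (c : R) (a : Heisenberg R n) : (c • a).x = c • a.x := rfl
@[simp] lemma smul_p (c : R) (a : Heisenberg R n) : (c • a).p = c • a.p := rfl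
@[simp] lemma smul_z (c : R) (a : Heisenberg R n) : (c • a).z = c * a.z := rfl
@[simp] lemma lie_x (a b : Heisenberg R n) : ⁅a, b⁆.x = 0 := rfl
@[simp] lemma lie_p (a b : Heisenberg R n) : ⁅a, b⁆.p = 0 := rfl
@[simp] lemma lie_z (a b : Heisenberg R n) : ⁅a, b⁆.z = a.x ⬝ᵥ b.p - b.x ⬝ᵥ a.p := rfl

instance : LieRing (Heisenberg R n) where
  add_lie a b c := by ext <;> simp [add_dotProduct, dotProduct_add]; ring
  lie_add a b c := by ext <;> simp [add_dotProduct, dotProduct_add]; ring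
  lie_self a := by ext <;> simp
  leibniz_lie a b c := by ext <;> simp

instance : LieAlgebra R (Heisenberg R n) where
  lie_smul c a b := by ext <;> simp [mul_sub]

/-- The standard action of a skew-symmetric matrix on the Heisenberg algebra: on each of the two
copies of the standard representation as usual, and trivially on the centre. -/
def rotation (A : so (Fin n) R) : LieDerivation R (Heisenberg R n) (Heisenberg R n) where
  toFun a := ⟨(A : Matrix (Fin n) (Fin n) R) *ᵥ a.x, (A : Matrix (Fin n) (Fin n) R) *ᵥ a.p, 0⟩
  map_add' a b := by ext <;> simp [mulVec_add]
  map_smul' c a := by ext <;> simp [mulVec_smul]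
  leibniz' a b := by
    have hA : (A : Matrix (Fin n) (Fin n) R)ᵀ = -A := (mem_so (Fin n) R _).1 A.2
    have key : ∀ u v : Fin n → R, u ⬝ᵥ ((A : Matrix (Fin n) (Fin n) R) *ᵥ v) =
        -(((A : Matrix (Fin n) (Fin n) R) *ᵥ u) ⬝ᵥ v) := fun u v => by
      rw [dotProduct_mulVec, ← mulVec_transpose, hA, neg_mulVec, neg_dotProduct]
    ext
    · simp
    · simp
    · simp [key]; ring

@[simp] lemma rotation_apply (A : so (Fin n) R) (a : Heisenberg R n) :
    rotation A a = ⟨(A : Matrix (Fin n) (Fin n) R) *ᵥ a.x,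
      (A : Matrix (Fin n) (Fin n) R) *ᵥ a.p, 0⟩ := rfl

variable (R n) in
/-- The action of `o(n)` on the Heisenberg algebra by derivations. -/
def action : so (Fin n) R →ₗ⁅R⁆ LieDerivation R (Heisenberg R n) (Heisenberg R n) where
  toFun := rotation
  map_add' A B := by ext <;> simp [add_mulVec]
  map_smul' c A := by ext <;> simp [smul_mulVec]
  map_lie' {A B} := by
    ext <;> simp [Ring.lie_def, sub_mulVec]

end Heisenberg

/-- The semidirect product `g_n = o(n) ⋉ h_n`. An element `a` has a Heisenberg part `a.left` and an
`o(n)` part `a.right`. -/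
abbrev G : Type _ := LieAlgebra.SemiDirectSum (Heisenberg R n) (so (Fin n) R)
  (Heisenberg.action R n)

variable {R n}

/-- `wedge u v = ∑ i, ∑ j, u i * v j • l_{ij}`, where `l_{ij} = E_{ji} - E_{ij} ∈ o(n)`. -/
def wedge (u v : Fin n → R) : so (Fin n) R :=
  ⟨vecMulVec v u - vecMulVec u v, by
    rw [mem_so, transpose_sub, transpose_vecMulVec, transpose_vecMulVec, neg_sub]⟩

lemma wedge_add_left (u u' v : Fin n → R) : wedge (u + u') v = wedge u v + wedge u' v :=
  Subtype.ext (by simp [wedge, add_vecMulVec, vecMulVec_add]; abel)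

lemma wedge_add_right (u v v' : Fin n → R) : wedge u (v + v') = wedge u v + wedge u v' :=
  Subtype.ext (by simp [wedge, add_vecMulVec, vecMulVec_add]; abel)

lemma wedge_smul_left (c : R) (u v : Fin n → R) : wedge (c • u) v = c • wedge u v :=
  Subtype.ext (by simp [wedge, smul_vecMulVec, vecMulVec_smul, smul_sub])

lemma wedge_smul_right (c : R) (u v : Fin n → R) : wedge u (c • v) = c • wedge u v :=
  Subtype.ext (by simp [wedge, smul_vecMulVec, vecMulVec_smul, smul_sub])

lemma wedge_self (u : Fin n → R) : wedge u u = 0 :=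
  Subtype.ext (by simp [wedge])

lemma wedge_swap (u v : Fin n → R) : wedge u v = -wedge v u :=
  Subtype.ext (by simp [wedge])

variable (R n)

/-- The 2-cochain `f₁` with `f₁(e_i, e_j) = l_{ij}` and `f₁(e_i, I) = -e_{n+i}`, and zero on the
other pairs of basis elements. -/
def f₁ : twoCochain R (G R n) (G R n) :=
  ⟨LinearMap.mk₂ R (fun a b => ⟨⟨0, a.left.z • b.left.x - b.left.z • a.left.x, 0⟩,
      wedge a.left.x b.left.x⟩)
    (fun a a' b => by
      ext1 <;> [(ext <;> simp <;> ring); simp [wedge_add_left]])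
    (fun c a b => by
      ext1 <;> [(ext <;> simp <;> ring); simp [wedge_smul_left]])
    (fun a b b' => by
      ext1 <;> [(ext <;> simp <;> ring); simp [wedge_add_right]])
    (fun c a b => by
      ext1 <;> [(ext <;> simp <;> ring); simp [wedge_smul_right]]),
   fun a => by
      ext1 <;> [(ext <;> simp); simp [wedge_self]]⟩

/-- The 2-cochain `f₂` with `f₂(e_{n+i}, e_{n+j}) = l_{ij}` and `f₂(e_{n+i}, I) = e_i`, and zero on
the other pairs of basis elements. -/
def f₂ : twoCochain R (G R n) (G R n) :=
  ⟨LinearMap.mk₂ R (fun a b => ⟨⟨b.left.z • a.left.p - a.left.z • b.left.p, 0, 0⟩,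
      wedge a.left.p b.left.p⟩)
    (fun a a' b => by
      ext1 <;> [(ext <;> simp <;> ring); simp [wedge_add_left]])
    (fun c a b => by
      ext1 <;> [(ext <;> simp <;> ring); simp [wedge_smul_left]])
    (fun a b b' => by
      ext1 <;> [(ext <;> simp <;> ring); simp [wedge_add_right]])
    (fun c a b => by
      ext1 <;> [(ext <;> simp <;> ring); simp [wedge_smul_right]]),
   fun a => by
      ext1 <;> [(ext <;> simp); simp [wedge_self]]⟩

/-- The 2-cochain `f₃` with `f₃(e_i, e_{n+j}) = l_{ij}`, `f₃(e_i, I) = e_i` and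
`f₃(e_{n+i}, I) = -e_{n+i}`, and zero on the other pairs of basis elements (up to antisymmetry). -/
def f₃ : twoCochain R (G R n) (G R n) :=
  ⟨LinearMap.mk₂ R (fun a b =>
      ⟨⟨b.left.z • a.left.x - a.left.z • b.left.x, a.left.z • b.left.p - b.left.z • a.left.p, 0⟩,
      wedge a.left.x b.left.p + wedge a.left.p b.left.x⟩)
    (fun a a' b => by
      ext1 <;> [(ext <;> simp <;> ring); (simp [wedge_add_left]; abel)])
    (fun c a b => by
      ext1 <;> [(ext <;> simp <;> ring); simp [wedge_smul_left]])
    (fun a b b' => by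
      ext1 <;> [(ext <;> simp <;> ring); (simp [wedge_add_right]; abel)])
    (fun c a b => by
      ext1 <;> [(ext <;> simp <;> ring); simp [wedge_smul_right]]),
   fun a => by
      ext1 <;> [(ext <;> simp); simp [wedge_swap a.left.p a.left.x]]⟩

/-- The three 2-cochains `f₁, f₂, f₃` as a family. -/
def f : Fin 3 → twoCochain R (G R n) (G R n) := ![f₁ R n, f₂ R n, f₃ R n]

variable {R}

/-- The bracket `[·,·]_ε = [·,·] + ε₁ f₁ + ε₂ f₂ + ε₃ f₃` on the vector space `g_n`. -/
def deformedBracket (ε : Fin 3 → R) : twoCochain R (G R n) (G R n) :=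
  bracketCochain R (G R n) + ∑ i, ε i • f R n i

/-- The coefficients of the powers of `t` in the family of brackets `[·,·]_{tε}`. -/
def deformedFamily (ε : Fin 3 → R) : ℕ → twoCochain R (G R n) (G R n)
  | 0 => bracketCochain R (G R n)
  | 1 => ∑ i, ε i • f R n i
  | _ + 2 => 0

end Heisenberg

end HeisDef

open HeisDef

/-!
The proof computes `H²(g_n, g_n)` by reducing an arbitrary 2-cocycle to a combination of
`f₁, f₂, f₃`.

The rotations `l_{ij}` act on `g_n` by skew-Hermitian operators, hence so they do on cochains. The
sum of the squares of skew-Hermitian operators splits the space of cocycles into their joint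
kernel and its own image, and by Cartan's formula the image consists of coboundaries. So every
class has an `o(n)`-invariant representative (`exists_so_invariant_cocycle`). The contraction of
an invariant cocycle with a commutator of rotations is an inner derivation, and `o(n)` is perfect
for `n ≥ 3`; subtracting a coboundary makes the cocycle vanish on `o(n)`
(`exists_cocycle_vanishing_on_rot`).

What remains is an invariant cochain on the Heisenberg algebra `V ⊕ V ⊕ ℂ I`, where `V` is the
standard representation. For `n ≥ 3`, equivariant endomorphisms of `V` are scalar, invariant
bilinear forms are multiples of the dot product and invariant trilinear forms are totally
antisymmetric (`exists_eq_smul_of_equivariant`, `exists_eq_smul_dotProduct`,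
`antisymm_of_equivariant`). Therefore `c(I, ·)` is a `2 × 2` matrix acting on `V ⊕ V = V ⊗ ℂ²`,
which is traceless by the cocycle identity; the cochains `f₁, f₂, f₃` realize a basis of these
matrices (`exists_apply_I_eq`). A cocycle vanishing on `o(n)` and `I` is a coboundary
(`exists_eq_coboundary`): its `o(n)`-components vanish by the argument that shows the uniqueness
of the Levi-Civita connection, its `V`-components are invariant trilinear forms (they are nonzero
only for `n = 3`), which are coboundaries of maps `V ⊕ V → o(n)`, and its `I`-component is a
multiple of the symplectic form, the coboundary of a multiple of the projection to `I`.
Conversely, a coboundary sends `(I, y)` to `⁅τ I, y⁆`, so it acts on each copy of `V` by a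
skew-symmetric matrix; this makes `f₁, f₂, f₃` independent (`eq_zero_of_sum_eq_coboundary`).

The Jacobi identity for `[·,·]_ε` is a direct computation (`jacobi_deformedBracket`). Applied to
`ε` and `-ε` it shows that the `f i` are cocycles and that `t ↦ g_n(tε)` is a formal deformation.
An arbitrary cocycle differs from some `∑ i, ε i • f i` by the coboundary of some `τ`, and
conjugating the family `g_n(tε)` by `id + tτ` changes its linear term by exactly that coboundary
(`exists_formalDeformation`).

Finally, `g_n(ε)` maps to `o(n+2)` when `!![ε 0, ε 2; ε 2, ε 1]` is the Gram matrix of two vectors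
`s, t` of the plane: the parts `x, p` become the off-diagonal block `x sᵀ + p tᵀ` and `I` becomes
a rotation of the plane (`blockMatrix_deformedBracket`). If the Gram matrix is nondegenerate, this
is an isomorphism, and over `ℂ` every symmetric matrix with nonzero first entry and nonzero
determinant is of this form (`nonempty_lieEquiv_so_complex`).
-/

namespace HeisDef

/-! ### Coordinates on `g_n` and the Jacobi identity for the deformed brackets -/

section Coordinates

variable {R : Type*} [CommRing R] {n : ℕ}

namespace G

lemma ext_coords {a b : G R n} (hx : a.left.x = b.left.x) (hp : a.left.p = b.left.p)
    (hz : a.left.z = b.left.z)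
    (hr : (a.right : Matrix (Fin n) (Fin n) R) = b.right) : a = b :=
  LieAlgebra.SemiDirectSum.ext (Heisenberg.ext hx hp hz) (Subtype.ext hr)

lemma add_left (a b : G R n) : (a + b).left = a.left + b.left := rfl
lemma add_right (a b : G R n) : (a + b).right = a.right + b.right := rfl
lemma sub_left (a b : G R n) : (a - b).left = a.left - b.left := rfl
lemma zero_left : (0 : G R n).left = 0 := rfl
lemma zero_right : (0 : G R n).right = 0 := rfl
lemma smul_left (c : R) (a : G R n) : (c • a).left = c • a.left := rfl
lemma smul_right (c : R) (a : G R n) : (c • a).right = c • a.right := rfl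

lemma lie_left_x (a b : G R n) :
    ⁅a, b⁆.left.x = a.right.1 *ᵥ b.left.x - b.right.1 *ᵥ a.left.x := by
  simp [Heisenberg.action]

lemma lie_left_p (a b : G R n) :
    ⁅a, b⁆.left.p = a.right.1 *ᵥ b.left.p - b.right.1 *ᵥ a.left.p := by
  simp [Heisenberg.action]

lemma lie_left_z (a b : G R n) :
    ⁅a, b⁆.left.z = a.left.x ⬝ᵥ b.left.p - b.left.x ⬝ᵥ a.left.p := by
  simp [Heisenberg.action]

lemma lie_right (a b : G R n) : ⁅a, b⁆.right = ⁅a.right, b.right⁆ := rfl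

lemma lie_right_val (a b : G R n) :
    (⁅a, b⁆.right : Matrix (Fin n) (Fin n) R) =
      a.right.1 * b.right.1 - b.right.1 * a.right.1 := rfl

end G

lemma so_transpose (A : so (Fin n) R) : A.1ᵀ = -A.1 := (mem_so (Fin n) R _).1 A.2

lemma so_dotProduct_mulVec (A : so (Fin n) R) (u v : Fin n → R) :
    u ⬝ᵥ (A.1 *ᵥ v) = -((A.1 *ᵥ u) ⬝ᵥ v) := by
  rw [dotProduct_mulVec, ← mulVec_transpose, so_transpose, neg_mulVec, neg_dotProduct]

lemma wedge_mulVec (u v w : Fin n → R) :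
    (wedge u v).1 *ᵥ w = (u ⬝ᵥ w) • v - (v ⬝ᵥ w) • u := by
  simp [wedge, sub_mulVec, vecMulVec_mulVec]

lemma so_mul_wedge (A : so (Fin n) R) (u v : Fin n → R) :
    A.1 * (wedge u v).1 - (wedge u v).1 * A.1 =
      (wedge (A.1 *ᵥ u) v).1 + (wedge u (A.1 *ᵥ v)).1 := by
  have h (w : Fin n → R) : w ᵥ* A.1 = -(A.1 *ᵥ w) := by
    rw [← mulVec_transpose, so_transpose, neg_mulVec]
  simp only [wedge, mul_sub, sub_mul, mul_vecMulVec, vecMulVec_mul, h]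
  simp only [vecMulVec_neg]
  abel

/-- An infinitesimal rotation acts on `wedge` by the Leibniz rule. -/
lemma so_lie_wedge (A : so (Fin n) R) (u v : Fin n → R) :
    ⁅A, wedge u v⁆ = wedge (A.1 *ᵥ u) v + wedge u (A.1 *ᵥ v) :=
  Subtype.ext (so_mul_wedge A u v)

lemma wedge_sub_left (u u' v : Fin n → R) : wedge (u - u') v = wedge u v - wedge u' v :=
  Subtype.ext (by simp [wedge, sub_vecMulVec, vecMulVec_sub]; abel)

lemma wedge_sub_right (u v v' : Fin n → R) : wedge u (v - v') = wedge u v - wedge u v' :=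
  Subtype.ext (by simp [wedge, sub_vecMulVec, vecMulVec_sub]; abel)

lemma deformedBracket_apply (ε : Fin 3 → R) (a b : G R n) :
    deformedBracket n ε a b =
      ⁅a, b⁆ + (ε 0 • f₁ R n a b + ε 1 • f₂ R n a b + ε 2 • f₃ R n a b) := by
  simp only [deformedBracket, Fin.sum_univ_three]
  rfl

lemma f₁_apply (a b : G R n) : f₁ R n a b =
    ⟨⟨0, a.left.z • b.left.x - b.left.z • a.left.x, 0⟩, wedge a.left.x b.left.x⟩ := rfl

lemma f₂_apply (a b : G R n) : f₂ R n a b =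
    ⟨⟨b.left.z • a.left.p - a.left.z • b.left.p, 0, 0⟩, wedge a.left.p b.left.p⟩ := rfl

lemma f₃_apply (a b : G R n) : f₃ R n a b =
    ⟨⟨b.left.z • a.left.x - a.left.z • b.left.x, a.left.z • b.left.p - b.left.z • a.left.p, 0⟩,
      wedge a.left.x b.left.p + wedge a.left.p b.left.x⟩ := rfl

lemma deformedBracket_left_x (ε : Fin 3 → R) (a b : G R n) :
    (deformedBracket n ε a b).left.x = a.right.1 *ᵥ b.left.x - b.right.1 *ᵥ a.left.x +
      (ε 1 • (b.left.z • a.left.p - a.left.z • b.left.p) +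
        ε 2 • (b.left.z • a.left.x - a.left.z • b.left.x)) := by
  rw [deformedBracket_apply]
  simp only [G.add_left, Heisenberg.add_x, G.lie_left_x, G.smul_left, Heisenberg.smul_x, f₁_apply,
    f₂_apply, f₃_apply, smul_zero, zero_add]

lemma deformedBracket_left_p (ε : Fin 3 → R) (a b : G R n) :
    (deformedBracket n ε a b).left.p = a.right.1 *ᵥ b.left.p - b.right.1 *ᵥ a.left.p +
      (ε 0 • (a.left.z • b.left.x - b.left.z • a.left.x) +
        ε 2 • (a.left.z • b.left.p - b.left.z • a.left.p)) := by
  rw [deformedBracket_apply]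
  simp only [G.add_left, Heisenberg.add_p, G.lie_left_p, G.smul_left, Heisenberg.smul_p, f₁_apply,
    f₂_apply, f₃_apply, smul_zero, add_zero]

lemma deformedBracket_left_z (ε : Fin 3 → R) (a b : G R n) :
    (deformedBracket n ε a b).left.z = a.left.x ⬝ᵥ b.left.p - b.left.x ⬝ᵥ a.left.p := by
  rw [deformedBracket_apply]
  simp only [G.add_left, Heisenberg.add_z, G.lie_left_z, G.smul_left, Heisenberg.smul_z, f₁_apply,
    f₂_apply, f₃_apply, mul_zero, add_zero]

lemma deformedBracket_right (ε : Fin 3 → R) (a b : G R n) :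
    (deformedBracket n ε a b).right = ⁅a.right, b.right⁆ +
      (ε 0 • wedge a.left.x b.left.x + ε 1 • wedge a.left.p b.left.p +
        ε 2 • (wedge a.left.x b.left.p + wedge a.left.p b.left.x)) := by
  rw [deformedBracket_apply]
  rfl

lemma so_lie_mulVec (A B : so (Fin n) R) (v : Fin n → R) :
    (⁅A, B⁆).1 *ᵥ v = A.1 *ᵥ (B.1 *ᵥ v) - B.1 *ᵥ (A.1 *ᵥ v) := by
  simp [Ring.lie_def, sub_mulVec]

lemma so_add_mulVec (A B : so (Fin n) R) (v : Fin n → R) :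
    (A + B).1 *ᵥ v = A.1 *ᵥ v + B.1 *ᵥ v := add_mulVec _ _ _

lemma so_smul_mulVec (c : R) (A : so (Fin n) R) (v : Fin n → R) :
    (c • A).1 *ᵥ v = c • (A.1 *ᵥ v) := smul_mulVec _ _ _

/-- The Jacobi identity holds for all parameters. In each component it becomes an identity between
polynomials once the dot products and the wedges are written with their arguments in a fixed
order. -/
theorem jacobi_deformedBracket (ε : Fin 3 → R) : Jacobi (deformedBracket n ε) := by
  intro a b c
  refine LieAlgebra.SemiDirectSum.ext (Heisenberg.ext ?_ ?_ ?_) ?_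
  · ext i
    simp only [G.add_left, Heisenberg.add_x, G.zero_left, Heisenberg.zero_x,
      deformedBracket_left_x, deformedBracket_left_p, deformedBracket_left_z,
      deformedBracket_right, so_add_mulVec, so_smul_mulVec,
      so_lie_mulVec, wedge_mulVec, mulVec_add, mulVec_sub, mulVec_smul,
      dotProduct_comm b.left.x a.left.x, dotProduct_comm c.left.x a.left.x,
      dotProduct_comm c.left.x b.left.x, dotProduct_comm b.left.p a.left.x,
      dotProduct_comm b.left.p c.left.x, dotProduct_comm c.left.p a.left.x,
      dotProduct_comm c.left.p b.left.x, dotProduct_comm a.left.p b.left.x,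
      dotProduct_comm a.left.p c.left.x]
    simp only [Pi.add_apply, Pi.sub_apply, Pi.smul_apply, smul_eq_mul, Pi.zero_apply]
    ring
  · ext i
    simp only [G.add_left, Heisenberg.add_p, G.zero_left, Heisenberg.zero_p,
      deformedBracket_left_x, deformedBracket_left_p, deformedBracket_left_z,
      deformedBracket_right, so_add_mulVec, so_smul_mulVec,
      so_lie_mulVec, wedge_mulVec, mulVec_add, mulVec_sub, mulVec_smul,
      dotProduct_comm b.left.p a.left.p, dotProduct_comm c.left.p a.left.p,
      dotProduct_comm c.left.p b.left.p]
    simp only [Pi.add_apply, Pi.sub_apply, Pi.smul_apply, smul_eq_mul, Pi.zero_apply]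
    ring
  · simp only [G.add_left, Heisenberg.add_z, G.zero_left, Heisenberg.zero_z,
      deformedBracket_left_x, deformedBracket_left_p, deformedBracket_left_z,
      add_dotProduct, sub_dotProduct, smul_dotProduct, dotProduct_add, dotProduct_sub,
      dotProduct_smul, so_dotProduct_mulVec, smul_eq_mul]
    simp only [dotProduct_comm b.left.x a.left.x, dotProduct_comm b.left.p a.left.p,
      dotProduct_comm c.left.x a.left.x, dotProduct_comm c.left.p a.left.p,
      dotProduct_comm c.left.x b.left.x, dotProduct_comm c.left.p b.left.p]
    ring
  · have hJ := lie_jacobi a.right b.right c.right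
    rw [← lie_skew a.right ⁅b.right, c.right⁆, ← lie_skew b.right ⁅c.right, a.right⁆,
      ← lie_skew c.right ⁅a.right, b.right⁆] at hJ
    simp only [G.add_right, G.zero_right,
      deformedBracket_left_x, deformedBracket_left_p, deformedBracket_right, add_lie, smul_lie]
    rw [← neg_eq_zero] at hJ
    refine Eq.trans ?_ hJ
    have hw (u v : Fin n → R) (A : so (Fin n) R) :
        ⁅wedge u v, A⁆ = wedge v (A.1 *ᵥ u) - wedge u (A.1 *ᵥ v) := by
      rw [← lie_skew, so_lie_wedge, wedge_swap (A.1 *ᵥ u) v]; abel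
    simp only [hw, neg_lie, wedge_add_left, wedge_sub_left, wedge_smul_left,
      wedge_swap (_ *ᵥ _) _, wedge_swap b.left.x a.left.x, wedge_swap b.left.p a.left.p,
      wedge_swap c.left.x a.left.x, wedge_swap c.left.p a.left.p,
      wedge_swap c.left.x b.left.x, wedge_swap c.left.p b.left.p,
      wedge_swap b.left.p a.left.x, wedge_swap b.left.p c.left.x,
      wedge_swap c.left.p a.left.x, wedge_swap c.left.p b.left.x,
      wedge_swap a.left.p b.left.x, wedge_swap a.left.p c.left.x]
    module

end Coordinates

/-! ### Nondegenerate parameters give `o(n + 2)` -/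

section Orthogonal

variable {R : Type*} [CommRing R] {n : ℕ}

/-- The block matrix in `o(n + 2)` attached to an element of `g_n`, for a pair `s, t` of vectors of
the plane: `x` and `p` become the off-diagonal block `x sᵀ + p tᵀ`, and `I` becomes an infinitesimal
rotation of the plane, scaled by the area spanned by `s` and `t`. -/
def blockMatrix (s t : Fin 2 → R) (a : G R n) : Matrix (Fin n ⊕ Fin 2) (Fin n ⊕ Fin 2) R :=
  fromBlocks a.right.1 (vecMulVec a.left.x s + vecMulVec a.left.p t)
    (-(vecMulVec s a.left.x + vecMulVec t a.left.p))
    (a.left.z • (vecMulVec t s - vecMulVec s t))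

lemma blockMatrix_mem_so (s t : Fin 2 → R) (a : G R n) :
    blockMatrix s t a ∈ so (Fin n ⊕ Fin 2) R := by
  rw [mem_so, blockMatrix, fromBlocks_transpose, fromBlocks_neg, so_transpose]
  congr 1
  · simp [transpose_vecMulVec]
  · simp [transpose_vecMulVec]
  · simp [transpose_vecMulVec, ← smul_neg]

lemma blockMatrix_add (s t : Fin 2 → R) (a b : G R n) :
    blockMatrix s t (a + b) = blockMatrix s t a + blockMatrix s t b := by
  simp only [blockMatrix, fromBlocks_add, G.add_left, G.add_right, Heisenberg.add_x,
    Heisenberg.add_p, Heisenberg.add_z, add_vecMulVec, vecMulVec_add]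
  congr 1
  · abel
  · abel
  · rw [← add_smul]

lemma blockMatrix_smul (s t : Fin 2 → R) (c : R) (a : G R n) :
    blockMatrix s t (c • a) = c • blockMatrix s t a := by
  simp only [blockMatrix, fromBlocks_smul, G.smul_left, G.smul_right, Heisenberg.smul_x,
    Heisenberg.smul_p, Heisenberg.smul_z, smul_vecMulVec, vecMulVec_smul, smul_neg, smul_add,
    mul_smul]
  rfl

/-- `blockMatrix s t` turns the deformed bracket into the commutator, when the parameters are the
entries of the Gram matrix of `s, t`. -/
lemma blockMatrix_deformedBracket (s t : Fin 2 → R) (a b : G R n) :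
    blockMatrix s t (deformedBracket n ![s ⬝ᵥ s, t ⬝ᵥ t, s ⬝ᵥ t] a b) =
      blockMatrix s t a * blockMatrix s t b - blockMatrix s t b * blockMatrix s t a := by
  have h (A : so (Fin n) R) (u : Fin 2 → R) (w : Fin n → R) :
      vecMulVec u w * A.1 = -vecMulVec u (A.1 *ᵥ w) := by
    rw [vecMulVec_mul, ← mulVec_transpose, so_transpose, neg_mulVec, vecMulVec_neg]
  simp only [blockMatrix, fromBlocks_multiply, sub_eq_add_neg (fromBlocks _ _ _ _),
    fromBlocks_neg, fromBlocks_add, Matrix.add_mul, Matrix.mul_add, Matrix.neg_mul, Matrix.mul_neg,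
    Matrix.sub_mul, Matrix.mul_sub, Matrix.smul_mul, Matrix.mul_smul, vecMulVec_mul_vecMulVec,
    mul_vecMulVec a.right.1, mul_vecMulVec b.right.1, h, dotProduct_comm t s]
  congr 1
  · rw [deformedBracket_right]
    ext i j
    simp [vecMulVec_apply, Ring.lie_def, wedge, -dotProduct_cons]
    ring
  · rw [deformedBracket_left_x, deformedBracket_left_p]
    ext i j
    simp [vecMulVec_apply]
    ring
  · rw [deformedBracket_left_x, deformedBracket_left_p]
    ext i j
    simp [vecMulVec_apply]
    ring
  · rw [deformedBracket_left_z]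
    ext i j
    simp [vecMulVec_apply, dotProduct_comm b.left.x a.left.x, dotProduct_comm b.left.p a.left.p,
      dotProduct_comm b.left.p a.left.x, dotProduct_comm a.left.p b.left.x]
    ring

variable {K : Type*} [Field K] [CharZero K]

/-- If the parameters are the entries of the Gram matrix of a basis of the plane, then the deformed
Lie algebra is `o(n + 2)`. -/
theorem nonempty_lieEquiv_so (s t : Fin 2 → K) (hst : s 0 * t 1 - s 1 * t 0 ≠ 0)
    (h : Jacobi (deformedBracket n ![s ⬝ᵥ s, t ⬝ᵥ t, s ⬝ᵥ t])) :
    Nonempty (WithBracket (deformedBracket n ![s ⬝ᵥ s, t ⬝ᵥ t, s ⬝ᵥ t]) h ≃ₗ⁅K⁆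
      so (Fin (n + 2)) K) := by
  let e : Fin n ⊕ Fin 2 ≃ Fin (n + 2) := finSumFinEquiv
  let F : WithBracket (deformedBracket n ![s ⬝ᵥ s, t ⬝ᵥ t, s ⬝ᵥ t]) h →ₗ⁅K⁆ so (Fin (n + 2)) K :=
    { toFun a := ⟨(blockMatrix s t (WithBracket.equiv _ h a)).submatrix e.symm e.symm, by
        have h := (mem_so _ _ _).1 (blockMatrix_mem_so s t (WithBracket.equiv _ h a))
        exact (mem_so _ _ _).2 (congrArg (fun M => M.submatrix e.symm e.symm) h)⟩
      map_add' a b := Subtype.ext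
        (congrArg (fun M => M.submatrix e.symm e.symm) (blockMatrix_add s t _ _))
      map_smul' c a := Subtype.ext
        (congrArg (fun M => M.submatrix e.symm e.symm) (blockMatrix_smul s t c _))
      map_lie' {a b} := Subtype.ext (by
        refine (congrArg (fun M => M.submatrix e.symm e.symm)
          (blockMatrix_deformedBracket s t _ _)).trans ?_
        rw [submatrix_sub, Pi.sub_apply, Pi.sub_apply,
          ← submatrix_mul_equiv _ _ _ e.symm, ← submatrix_mul_equiv _ _ _ e.symm]
        rfl) }
  refine ⟨LieEquiv.ofBijective F ⟨?_, fun X => ?_⟩⟩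
  · rw [injective_iff_map_eq_zero]
    intro a ha
    have ha₁ : (blockMatrix s t (WithBracket.equiv _ h a)).submatrix e.symm e.symm = 0 :=
      congrArg Subtype.val ha
    have ha₂ (i j) : blockMatrix s t (WithBracket.equiv _ h a) i j = 0 := by
      have := congrFun (congrFun ha₁ (e i)) (e j)
      rwa [submatrix_apply, e.symm_apply_apply, e.symm_apply_apply] at this
    refine (WithBracket.equiv _ h).injective ?_
    generalize WithBracket.equiv _ h a = a' at ha₂ ⊢
    rw [map_zero]
    have h12 (i : Fin n) (j : Fin 2) : a'.left.x i * s j + a'.left.p i * t j = 0 :=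
      ha₂ (Sum.inl i) (Sum.inr j)
    have hz : a'.left.z * (t 0 * s 1 - s 0 * t 1) = 0 := ha₂ (Sum.inr 0) (Sum.inr 1)
    refine G.ext_coords (funext fun i => ?_) (funext fun i => ?_) ?_ ?_
    · have : a'.left.x i * (s 0 * t 1 - s 1 * t 0) = 0 := by
        linear_combination t 1 * h12 i 0 - t 0 * h12 i 1
      exact (mul_eq_zero.1 this).resolve_right hst
    · have : a'.left.p i * (s 0 * t 1 - s 1 * t 0) = 0 := by
        linear_combination s 0 * h12 i 1 - s 1 * h12 i 0
      exact (mul_eq_zero.1 this).resolve_right hst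
    · have : a'.left.z * (s 0 * t 1 - s 1 * t 0) = 0 := by linear_combination -hz
      exact (mul_eq_zero.1 this).resolve_right hst
    · ext i j
      exact ha₂ (Sum.inl i) (Sum.inl j)
  · have hX (i j) : X.1 j i = -X.1 i j :=
      congrFun (congrFun ((mem_so _ _ _).1 X.2) i) j
    let d := s 0 * t 1 - s 1 * t 0
    let Y (i j) := X.1 (e i) (e j)
    let b : G K n := ⟨⟨
        fun i => (Y (Sum.inl i) (Sum.inr 0) * t 1 - Y (Sum.inl i) (Sum.inr 1) * t 0) / d,
        fun i => (s 0 * Y (Sum.inl i) (Sum.inr 1) - s 1 * Y (Sum.inl i) (Sum.inr 0)) / d,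
        -Y (Sum.inr 0) (Sum.inr 1) / d⟩,
      ⟨of fun i j => Y (Sum.inl i) (Sum.inl j), by
        rw [mem_so]
        ext i j
        exact hX _ _⟩⟩
    have h12 (i : Fin n) (j : Fin 2) :
        b.left.x i * s j + b.left.p i * t j = Y (Sum.inl i) (Sum.inr j) := by
      have hd : d ≠ 0 := hst
      fin_cases j
      · simp only [b]
        field_simp
        simp only [d, Fin.zero_eta]
        ring
      · simp only [b]
        field_simp
        simp only [d, Fin.mk_one]
        ring
    have h22 : b.left.z * (t 0 * s 1 - s 0 * t 1) = Y (Sum.inr 0) (Sum.inr 1) := by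
      have hd : d ≠ 0 := hst
      simp only [b]
      field_simp
      simp only [d]
      ring
    have hY' (i j) : Y j i = -Y i j := hX _ _
    have hY (i j) : blockMatrix s t b i j = Y i j := by
      rcases i with i | i <;> rcases j with j | j
      · rfl
      · exact h12 i j
      · rw [hY' (Sum.inl j) (Sum.inr i), ← h12 j i]
        change -(s i * _ + t i * _) = _
        ring
      · have h0 (k) : Y k k = 0 := self_eq_neg.1 (hY' k k)
        fin_cases i <;> fin_cases j
        · refine Eq.trans ?_ (h0 _).symm
          change b.left.z * (t 0 * s 0 - s 0 * t 0) = 0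
          ring
        · exact h22
        · refine Eq.trans ?_ (hY' (Sum.inr 0) (Sum.inr 1)).symm
          rw [← h22]
          change b.left.z * (t 1 * s 0 - s 1 * t 0) = _
          ring
        · refine Eq.trans ?_ (h0 _).symm
          change b.left.z * (t 1 * s 1 - s 1 * t 1) = 0
          ring
    refine ⟨(WithBracket.equiv _ h).symm b, Subtype.ext ?_⟩
    ext i j
    refine (hY _ _).trans ?_
    simp only [Y, e.apply_symm_apply]

/-- If `ε 0 ≠ 0` and `!![ε 0, ε 2; ε 2, ε 1]` is invertible, then the deformed Lie algebra is
`o(n + 2)`: over `ℂ` this matrix is the Gram matrix of a basis of the plane. -/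
theorem nonempty_lieEquiv_so_complex (ε : Fin 3 → ℂ) (h : Jacobi (deformedBracket n ε))
    (h0 : ε 0 ≠ 0) (h2 : ε 2 ^ 2 ≠ ε 0 * ε 1) :
    Nonempty (WithBracket (deformedBracket n ε) h ≃ₗ⁅ℂ⁆ so (Fin (n + 2)) ℂ) := by
  -- A triangular square root of the Gram matrix `!![ε 0, ε 2; ε 2, ε 1]`.
  obtain ⟨a, ha⟩ := IsAlgClosed.exists_pow_nat_eq (ε 0) zero_lt_two
  have ha0 : a ≠ 0 := by rintro rfl; simp_all
  obtain ⟨c, hc⟩ := IsAlgClosed.exists_pow_nat_eq (ε 1 - (ε 2 / a) ^ 2) zero_lt_two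
  have hc0 : c ≠ 0 := by
    rintro rfl
    apply h2
    field_simp at hc
    rw [← ha]
    linear_combination hc
  have hε : ε = ![![a, 0] ⬝ᵥ ![a, 0], ![ε 2 / a, c] ⬝ᵥ ![ε 2 / a, c],
      ![a, 0] ⬝ᵥ ![ε 2 / a, c]] := by
    ext i
    fin_cases i
    · simp [← ha]; ring
    · simp; linear_combination -hc
    · simp; field_simp
  revert h
  rw [hε]
  intro h
  exact nonempty_lieEquiv_so _ _ (by simp [ha0, hc0]) h

end Orthogonal

/-! ### Power series with coefficients in a Lie algebra -/

section FormalSeries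

variable {R L : Type*} [CommRing R] [LieRing L] [LieAlgebra R L]

variable (R L) in
/-- Multiplication by `t` on formal power series `∑ tᵏ u k` with coefficients in `L`, which are
encoded as sequences `ℕ → L`. -/
def shift : (ℕ → L) →ₗ[R] (ℕ → L) where
  toFun u k := Nat.casesOn k 0 u
  map_add' u v := by ext k; cases k <;> simp
  map_smul' c u := by ext k; cases k <;> simp

@[simp] lemma shift_zero (u : ℕ → L) : shift R L u 0 = 0 := rfl
@[simp] lemma shift_succ (u : ℕ → L) (k : ℕ) : shift R L u (k + 1) = u k := rfl

variable (R L) in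
/-- A vector as a constant power series. -/
abbrev const : L →ₗ[R] (ℕ → L) := LinearMap.single R (fun _ : ℕ => L) 0

lemma eq_const_add_shift (u : ℕ → L) :
    u = const R L (u 0) + shift R L fun k => u (k + 1) := by
  ext k
  cases k <;> simp

/-- A `t`-linear operator on power series is determined by its values on constants. -/
lemma apply_eq_sum_const {F : (ℕ → L) →ₗ[R] (ℕ → L)}
    (hF : ∀ u, F (shift R L u) = shift R L (F u)) (u : ℕ → L) (k : ℕ) :
    F u k = ∑ ij ∈ Finset.HasAntidiagonal.antidiagonal k, F (const R L (u ij.2)) ij.1 := by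
  induction k generalizing u with
  | zero =>
    conv_lhs => rw [eq_const_add_shift (R := R) u, map_add, hF]
    simp
  | succ k ih =>
    conv_lhs => rw [eq_const_add_shift (R := R) u, map_add, hF]
    rw [Finset.Nat.sum_antidiagonal_succ', Pi.add_apply, shift_succ, ih]

lemma eq_zero_of_const {F : (ℕ → L) →ₗ[R] (ℕ → L)}
    (hF : ∀ u, F (shift R L u) = shift R L (F u)) (h : ∀ x, F (const R L x) = 0) (u : ℕ → L) :
    F u = 0 := by
  ext k
  rw [apply_eq_sum_const hF]
  simp only [h, Pi.zero_apply, Finset.sum_const_zero]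

/-- The `t`-bilinear extension to power series of a family of brackets `∑ tᵏ φ k`. -/
def seriesBracket (φ : ℕ → twoCochain R L L) : (ℕ → L) →ₗ[R] (ℕ → L) →ₗ[R] (ℕ → L) :=
  LinearMap.mk₂ R (fun u v k => ∑ ij ∈ Finset.HasAntidiagonal.antidiagonal k,
      ∑ pq ∈ Finset.HasAntidiagonal.antidiagonal ij.2, φ ij.1 (u pq.1) (v pq.2))
    (fun u u' v => by ext k; simp [Finset.sum_add_distrib])
    (fun c u v => by ext k; simp [Finset.smul_sum])
    (fun u v v' => by ext k; simp [Finset.sum_add_distrib])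
    (fun c u v => by ext k; simp [Finset.smul_sum])

lemma seriesBracket_apply (φ : ℕ → twoCochain R L L) (u v : ℕ → L) (k : ℕ) :
    seriesBracket φ u v k = ∑ ij ∈ Finset.HasAntidiagonal.antidiagonal k,
      ∑ pq ∈ Finset.HasAntidiagonal.antidiagonal ij.2, φ ij.1 (u pq.1) (v pq.2) := rfl

lemma seriesBracket_const (φ : ℕ → twoCochain R L L) (x y : L) (k : ℕ) :
    seriesBracket φ (const R L x) (const R L y) k = φ k x y := by
  rw [seriesBracket_apply]
  cases k with
  | zero => simp
  | succ k =>
    rw [Finset.Nat.sum_antidiagonal_succ', add_eq_left.2 (Finset.sum_eq_zero fun ij _ => ?_)]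
    · simp
    · rw [Finset.Nat.sum_antidiagonal_succ']
      simp

lemma seriesBracket_shift_left (φ : ℕ → twoCochain R L L) (u v : ℕ → L) :
    seriesBracket φ (shift R L u) v = shift R L (seriesBracket φ u v) := by
  ext k
  rw [seriesBracket_apply]
  cases k with
  | zero => simp
  | succ k =>
    rw [Finset.Nat.sum_antidiagonal_succ']
    simp [Finset.Nat.sum_antidiagonal_succ, seriesBracket_apply]

lemma seriesBracket_shift_right (φ : ℕ → twoCochain R L L) (u v : ℕ → L) :
    seriesBracket φ u (shift R L v) = shift R L (seriesBracket φ u v) := by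
  ext k
  rw [seriesBracket_apply]
  cases k with
  | zero => simp
  | succ k =>
    rw [Finset.Nat.sum_antidiagonal_succ']
    simp [Finset.Nat.sum_antidiagonal_succ', seriesBracket_apply]

/-- The Jacobi identity for a `t`-bilinear bracket on power series follows from the one on
constants. -/
lemma series_jacobi_of_const {M : (ℕ → L) →ₗ[R] (ℕ → L) →ₗ[R] (ℕ → L)}
    (hl : ∀ u v, M (shift R L u) v = shift R L (M u v))
    (hr : ∀ u v, M u (shift R L v) = shift R L (M u v))
    (h : ∀ x y z : L, M (M (const R L x) (const R L y)) (const R L z) +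
      M (M (const R L y) (const R L z)) (const R L x) +
      M (M (const R L z) (const R L x)) (const R L y) = 0) (u v w : ℕ → L) :
    M (M u v) w + M (M v w) u + M (M w u) v = 0 := by
  have key (v w : ℕ → L) (hc : ∀ x : L, M (M (const R L x) v) w + M (M v w) (const R L x) +
      M (M w (const R L x)) v = 0) (u : ℕ → L) :
      M (M u v) w + M (M v w) u + M (M w u) v = 0 := by
    refine eq_zero_of_const (F := M.flip w ∘ₗ M.flip v + M (M v w) + M.flip v ∘ₗ M w)
      (fun u => ?_) hc u
    simp [hl, hr]
  refine key v w (fun x => ?_) u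
  rw [add_rotate]
  refine key w (const R L x) (fun y => ?_) v
  rw [add_rotate]
  refine key (const R L x) (const R L y) (fun z => ?_) w
  rw [add_rotate]
  exact h x y z

end FormalSeries

/-! ### Changing a formal deformation by a coboundary -/

section Transport

variable {K L : Type*} [Field K] [LieRing L] [LieAlgebra K L]

/-- The operator `id + t τ` on power series. -/
def oneAddShift (τ : L →ₗ[K] L) : (ℕ → L) →ₗ[K] (ℕ → L) :=
  LinearMap.id + shift K L ∘ₗ τ.compLeft ℕ

lemma oneAddShift_zero (τ : L →ₗ[K] L) (u : ℕ → L) : oneAddShift τ u 0 = u 0 := by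
  simp [oneAddShift]

lemma oneAddShift_succ (τ : L →ₗ[K] L) (u : ℕ → L) (k : ℕ) :
    oneAddShift τ u (k + 1) = u (k + 1) + τ (u k) := by
  simp [oneAddShift]

lemma oneAddShift_shift (τ : L →ₗ[K] L) (u : ℕ → L) :
    oneAddShift τ (shift K L u) = shift K L (oneAddShift τ u) := by
  ext k
  rcases k with _ | _ | k <;> simp [oneAddShift_zero, oneAddShift_succ]

lemma oneAddShift_bijective (τ : L →ₗ[K] L) : Function.Bijective (oneAddShift τ) := by
  constructor
  · rw [injective_iff_map_eq_zero]
    intro u hu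
    ext k
    induction k with
    | zero => simpa [oneAddShift_zero] using congrFun hu 0
    | succ k ih => simpa [oneAddShift_succ, ih] using congrFun hu (k + 1)
  · intro u
    refine ⟨Nat.rec (u 0) fun k a => u (k + 1) - τ a, ?_⟩
    ext k
    cases k <;> simp [oneAddShift_zero, oneAddShift_succ]

/-- Transporting a formal family of Lie brackets along `id + t τ` yields a formal deformation, whose
first order term differs from that of the original family by the coboundary of `τ`. -/
theorem exists_formalDeformation [CharZero K] (φ' : ℕ → twoCochain K L L)
    (hφ' : IsFormalDeformation φ') (τ : L →ₗ[K] L) : ∃ φ : ℕ → twoCochain K L L,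
      IsFormalDeformation φ ∧ φ 1 = φ' 1 + d₁₂ K L L τ ∧ FormallyEquivalent φ φ' := by
  let T := LinearEquiv.ofBijective (oneAddShift τ) (oneAddShift_bijective τ)
  have hT (u : ℕ → L) : T u = oneAddShift τ u := rfl
  have hTs (u : ℕ → L) : T (shift K L u) = shift K L (T u) := oneAddShift_shift τ u
  have hTs' (u : ℕ → L) : T.symm (shift K L u) = shift K L (T.symm u) := by
    rw [T.symm_apply_eq, hTs, T.apply_symm_apply]
  have hM'l := seriesBracket_shift_left φ'
  have hM'r := seriesBracket_shift_right φ'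
  have hM'J (u v w : ℕ → L) : seriesBracket φ' (seriesBracket φ' u v) w +
      seriesBracket φ' (seriesBracket φ' v w) u +
        seriesBracket φ' (seriesBracket φ' w u) v = 0 := by
    refine series_jacobi_of_const hM'l hM'r (fun x y z => ?_) u v w
    ext k
    have h (a : ℕ → L) (z : L) (k : ℕ) : seriesBracket φ' a (const K L z) k =
        ∑ ij ∈ Finset.HasAntidiagonal.antidiagonal k, φ' ij.1 (a ij.2) z := by
      refine (apply_eq_sum_const (F := (seriesBracket φ').flip (const K L z))
        (fun u => hM'l u _) a k).trans ?_
      exact Finset.sum_congr rfl fun ij _ => seriesBracket_const φ' _ _ _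
    simp only [Pi.add_apply, Pi.zero_apply]
    rw [h, h, h, ← hφ'.2 k x y z, ← Finset.sum_add_distrib, ← Finset.sum_add_distrib]
    refine Finset.sum_congr rfl fun ij _ => ?_
    rw [seriesBracket_const, seriesBracket_const, seriesBracket_const]
  have hM'skew (u v : ℕ → L) : seriesBracket φ' u v + seriesBracket φ' v u = 0 := by
    refine eq_zero_of_const (F := (seriesBracket φ').flip v + seriesBracket φ' v)
      (fun u => ?_) (fun x => ?_) u
    · simp [hM'l, hM'r]
    · refine eq_zero_of_const
        (F := seriesBracket φ' (const K L x) + (seriesBracket φ').flip (const K L x))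
        (fun u => ?_) (fun y => ?_) v
      · simp [hM'l, hM'r]
      · ext k
        change seriesBracket φ' (const K L x) (const K L y) k +
          seriesBracket φ' (const K L y) (const K L x) k = 0
        rw [seriesBracket_const, seriesBracket_const, ← twoCochain_skew, neg_add_cancel]
  let M : (ℕ → L) →ₗ[K] (ℕ → L) →ₗ[K] (ℕ → L) :=
    ((seriesBracket φ').compl₁₂ T.toLinearMap T.toLinearMap).compr₂ T.symm.toLinearMap
  have hM (u v : ℕ → L) : M u v = T.symm (seriesBracket φ' (T u) (T v)) := rfl
  have hTM (u v : ℕ → L) : T (M u v) = seriesBracket φ' (T u) (T v) := T.apply_symm_apply _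
  have hMl (u v : ℕ → L) : M (shift K L u) v = shift K L (M u v) := by
    rw [hM, hTs, hM'l, hTs', hM]
  have hMJ (u v w : ℕ → L) : M (M u v) w + M (M v w) u + M (M w u) v = 0 := by
    apply T.injective
    rw [map_add, map_add, hTM, hTM, hTM, hTM, hTM, hTM, hM'J, map_zero]
  let φ (k : ℕ) : twoCochain K L L :=
    ⟨(M.compl₁₂ (const K L) (const K L)).compr₂ (LinearMap.proj k), fun x => by
      have h : M (const K L x) (const K L x) = 0 := by
        have h2 := hM'skew (T (const K L x)) (T (const K L x))
        rw [← two_smul K, smul_eq_zero_iff_right two_ne_zero] at h2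
        rw [hM, h2, map_zero]
      exact congrFun h k⟩
  have hφ (k : ℕ) (x y : L) : φ k x y = M (const K L x) (const K L y) k := rfl
  have hMconst (a : ℕ → L) (z : L) (k : ℕ) : M a (const K L z) k =
      ∑ ij ∈ Finset.HasAntidiagonal.antidiagonal k, φ ij.1 (a ij.2) z :=
    apply_eq_sum_const (F := M.flip (const K L z)) (fun u => hMl u _) a k
  have hT0 (x : L) : T (const K L x) 0 = x := by simp [hT, oneAddShift_zero]
  have hT1 (x : L) : T (const K L x) 1 = τ x := by simp [hT, oneAddShift_succ]
  have hφ0 (x y : L) : φ 0 x y = ⁅x, y⁆ := by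
    have h := congrFun (hTM (const K L x) (const K L y)) 0
    rw [hT, oneAddShift_zero] at h
    rw [hφ, h, seriesBracket_apply]
    simp only [Finset.Nat.antidiagonal_zero, Finset.sum_singleton, hT0, hφ'.1]
    rfl
  refine ⟨φ, ⟨?_, fun k x y z => ?_⟩, ?_, ?_⟩
  · exact DFunLike.ext _ _ fun x => LinearMap.ext fun y => hφ0 x y
  · have h := congrFun (hMJ (const K L x) (const K L y) (const K L z)) k
    simp only [Pi.add_apply, Pi.zero_apply] at h
    rw [hMconst, hMconst, hMconst] at h
    simp only [← hφ] at h
    rw [Finset.sum_add_distrib, Finset.sum_add_distrib, h]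
  · refine DFunLike.ext _ _ fun x => LinearMap.ext fun y => ?_
    have h := congrFun (hTM (const K L x) (const K L y)) 1
    rw [hT, oneAddShift_succ, ← hφ, ← hφ, hφ0, seriesBracket_apply,
      Finset.Nat.sum_antidiagonal_succ] at h
    simp only [Finset.Nat.sum_antidiagonal_succ, Finset.Nat.antidiagonal_zero, Finset.sum_singleton,
      zero_add, hT0, hT1, hφ'.1] at h
    rw [add_apply_apply, d₁₂_apply_apply, ← lie_skew y, sub_neg_eq_add, eq_sub_of_add_eq h]
    change ⁅x, τ y⁆ + ⁅τ x, y⁆ + _ - _ = _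
    abel
  · refine ⟨fun k => LinearMap.proj k ∘ₗ T.toLinearMap ∘ₗ const K L, LinearMap.ext hT0,
      fun k x y => ?_⟩
    have h := congrFun (hTM (const K L x) (const K L y)) k
    exact (apply_eq_sum_const (F := T.toLinearMap) hTs _ k).symm.trans h

end Transport

/-! ### Skew-Hermitian operators -/

section SkewOperators

open scoped ComplexOrder

/-- A finite-dimensional complex vector space with a positive definite Hermitian form (the pullback
of the standard one along an injective `J`) decomposes, for every finite family of skew-Hermitian
operators `D k`, into the joint kernel of the `D k` and the image of `∑ k, D k ^ 2`. -/
lemma exists_add_sum_sq_of_skew {V κ m : Type*} [AddCommGroup V] [Module ℂ V]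
    [FiniteDimensional ℂ V] [Fintype κ] [Fintype m] (J : V →ₗ[ℂ] (m → ℂ))
    (hJ : Function.Injective J) (D : κ → V →ₗ[ℂ] V)
    (hD : ∀ k v w, star (J (D k v)) ⬝ᵥ J w = -(star (J v) ⬝ᵥ J (D k w))) (v : V) :
    ∃ v₀ w, (∀ k, D k v₀ = 0) ∧ v = v₀ + ∑ k, D k (D k w) := by
  let Ω : V →ₗ[ℂ] V := ∑ k, D k ∘ₗ D k
  have hΩ (v) : Ω v = ∑ k, D k (D k v) := by simp [Ω]
  have hpair (v w) : star (J (Ω v)) ⬝ᵥ J w = -∑ k, star (J (D k v)) ⬝ᵥ J (D k w) := by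
    rw [hΩ, map_sum, star_sum, sum_dotProduct, ← Finset.sum_neg_distrib]
    exact Finset.sum_congr rfl fun k _ => hD k _ _
  have hzero (v) (h : star (J v) ⬝ᵥ J v = 0) : v = 0 :=
    hJ ((dotProduct_star_self_eq_zero.1 h).trans (map_zero J).symm)
  have h1 (v) (h : Ω v = 0) (k) : D k v = 0 := by
    have h2 := hpair v v
    rw [h, map_zero, star_zero, zero_dotProduct, zero_eq_neg,
      Finset.sum_eq_zero_iff_of_nonneg fun k _ => dotProduct_star_self_nonneg _] at h2
    exact hzero _ (h2 k (Finset.mem_univ k))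
  have h2 : Disjoint (LinearMap.ker Ω) (LinearMap.range Ω) := by
    rw [Submodule.disjoint_def]
    rintro _ h ⟨w, rfl⟩
    have hk := h1 _ h
    apply hzero
    rw [hpair]
    rw [Finset.sum_eq_zero fun k _ => by rw [hk, map_zero, dotProduct_zero], neg_zero]
  have h3 : LinearMap.ker Ω ⊔ LinearMap.range Ω = ⊤ := by
    apply Submodule.eq_top_of_disjoint _ _ ?_ h2
    rw [add_comm, LinearMap.finrank_range_add_finrank_ker]
  obtain ⟨v₀, hv₀, _, ⟨w, rfl⟩, h⟩ := Submodule.mem_sup.1 (h3 ▸ Submodule.mem_top (x := v))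
  exact ⟨v₀, w, h1 _ hv₀, by rw [← hΩ, h]⟩

lemma skew_dotProduct {m : Type*} [Fintype m] {M : Matrix m m ℂ} (hM : Mᴴ = -M) (f g : m → ℂ) :
    star (M *ᵥ f) ⬝ᵥ g = -(star f ⬝ᵥ (M *ᵥ g)) := by
  rw [star_mulVec, hM, vecMul_neg, neg_dotProduct, dotProduct_mulVec]

/-- A positive definite Hermitian form admits a basis in which all skew operators are given by
skew-Hermitian matrices. -/
lemma exists_basis_skew {V : Type*} [AddCommGroup V] [Module ℂ V] [FiniteDimensional ℂ V]
    (core : InnerProductSpace.Core ℂ V) :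
    ∃ u : Module.Basis (Fin (Module.finrank ℂ V)) ℂ V, ∀ X : V →ₗ[ℂ] V,
      (∀ v w, core.inner (X v) w = -core.inner v (X w)) →
        (LinearMap.toMatrix u u X)ᴴ = -LinearMap.toMatrix u u X := by
  let _ : NormedAddCommGroup V := core.toNormedAddCommGroup
  let _ : InnerProductSpace ℂ V := InnerProductSpace.ofCore core.toCore
  let u := stdOrthonormalBasis ℂ V
  refine ⟨u.toBasis, fun X hX => ?_⟩
  ext a b
  have h := hX (u a) (u b)
  change inner ℂ (X (u a)) (u b) = -inner ℂ (u a) (X (u b)) at h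
  rw [conjTranspose_apply, LinearMap.toMatrix_apply, Matrix.neg_apply, LinearMap.toMatrix_apply]
  simp only [OrthonormalBasis.coe_toBasis, OrthonormalBasis.coe_toBasis_repr_apply,
    OrthonormalBasis.repr_apply_apply]
  rw [← h]
  exact inner_conj_symm _ _

end SkewOperators

/-! ### Contractions and Cartan's formula -/

section Cartan

variable {R L : Type*} [CommRing R] [LieRing L] [LieAlgebra R L]

variable (R L) in
/-- The 2-cocycles with adjoint coefficients. -/
abbrev Z2 := twoCocycle R L L

/-- Contraction of a 2-cocycle with an element, as a linear map. -/
def contraction (x : L) : twoCocycle R L L →ₗ[R] oneCochain R L L where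
  toFun c := c.1 x
  map_add' _ _ := rfl
  map_smul' _ _ := rfl

/-- The Lie derivative of the cochain `c` along `x` vanishes. -/
def InvariantUnder (x : L) (c : twoCochain R L L) : Prop :=
  ∀ y z, ⁅x, c y z⁆ = c ⁅x, y⁆ z + c y ⁅x, z⁆

lemma twoCocycle_apply_eq {c : twoCochain R L L} (hc : c ∈ twoCocycle R L L) (x y z : L) :
    ⁅x, c y z⁆ - ⁅y, c x z⁆ + ⁅z, c x y⁆ - c ⁅x, y⁆ z + c ⁅x, z⁆ y - c ⁅y, z⁆ x = 0 := by
  rw [mem_twoCocycle_iff] at hc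
  rw [← d₂₃_apply, hc]
  rfl

/-- Cartan's formula: the coboundary of a contraction of a cocycle is a Lie derivative. -/
lemma coboundaryMap_contraction (x : L) (c : twoCocycle R L L) (y z : L) :
    (coboundaryMap R L (contraction x c)).1 y z = ⁅x, c.1 y z⁆ - c.1 ⁅x, y⁆ z - c.1 y ⁅x, z⁆ := by
  have h := twoCocycle_apply_eq c.2 x y z
  have h1 : (coboundaryMap R L (contraction x c)).1 y z =
    ⁅y, c.1 x z⁆ - ⁅z, c.1 x y⁆ - c.1 x ⁅y, z⁆ := rfl
  have h2 := twoCochain_skew c.1 y ⁅x, z⁆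
  have h3 := twoCochain_skew c.1 x ⁅y, z⁆
  rw [h1, ← sub_eq_zero, ← neg_eq_zero, ← h, ← h2, ← h3]
  abel

end Cartan

/-! ### Invariant representatives of cohomology classes -/

section Averaging

/-- If finitely many elements of a complex Lie algebra act in a suitable basis by skew-Hermitian
matrices, then every 2-cocycle is cohomologous to one that is invariant under these elements. -/
theorem exists_span_invariant_cocycle {L : Type*} [LieRing L] [LieAlgebra ℂ L]
    [FiniteDimensional ℂ L] {κ m : Type*} [Fintype κ] [Fintype m] [DecidableEq m]
    (u : Module.Basis m ℂ L) (l : κ → L)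
    (hl : ∀ k, (LinearMap.toMatrix u u (LieAlgebra.ad ℂ L (l k)))ᴴ =
      -LinearMap.toMatrix u u (LieAlgebra.ad ℂ L (l k)))
    (c : twoCocycle ℂ L L) : ∃ (c₀ : twoCocycle ℂ L L) (τ : L →ₗ[ℂ] L),
      (∀ x ∈ Submodule.span ℂ (Set.range l), InvariantUnder x c₀.1) ∧
        c = c₀ + coboundaryMap ℂ L τ := by
  have : FiniteDimensional ℂ (twoCochain ℂ L L) :=
    inferInstanceAs (FiniteDimensional ℂ (twoCochain ℂ L L : Submodule ℂ (L →ₗ[ℂ] L →ₗ[ℂ] L)))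
  have : FiniteDimensional ℂ (twoCocycle ℂ L L) := inferInstance
  let J : twoCocycle ℂ L L →ₗ[ℂ] (m × m × m → ℂ) :=
    { toFun c i := u.repr (c.1 (u i.1) (u i.2.1)) i.2.2
      map_add' c c' := by
        ext i
        change u.repr (c.1 _ _ + c'.1 _ _) _ = _
        simp
      map_smul' t c := by
        ext i
        change u.repr (t • c.1 _ _) _ = _
        simp }
  have hJ : Function.Injective J := by
    intro c c' h
    refine Subtype.ext (Subtype.ext ?_)
    refine u.ext fun a => u.ext fun b => u.ext_elem fun d => ?_
    exact congrFun h (a, b, d)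
  -- By Cartan's formula the Lie derivative `D k` along `l k` takes values in the coboundaries. It
  -- is skew-Hermitian for the pullback of the standard Hermitian form along the coordinates `J`.
  let D (k : κ) : twoCocycle ℂ L L →ₗ[ℂ] twoCocycle ℂ L L := coboundaryMap ℂ L ∘ₗ contraction (l k)
  let X (k : κ) := LinearMap.toMatrix u u (LieAlgebra.ad ℂ L (l k))
  have hX (k : κ) (v : L) : ⇑(u.repr ⁅l k, v⁆) = X k *ᵥ ⇑(u.repr v) := by
    rw [LinearMap.toMatrix_mulVec_repr]
    rfl
  have hXT (k : κ) : (X k)ᵀᴴ = -(X k)ᵀ := by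
    rw [← transpose_neg, ← hl k]; rfl
  have hXu (k : κ) (b : m) : ⁅l k, u b⁆ = ∑ e, (X k)ᵀ b e • u e := by
    rw [← u.sum_repr ⁅l k, u b⁆]
    refine Finset.sum_congr rfl fun e _ => ?_
    exact congrArg (· • u e) (LinearMap.toMatrix_apply u u (LieAlgebra.ad ℂ L (l k)) e b).symm
  have hJD (k : κ) (c) (a b d : m) : J (D k c) (a, b, d) =
      (X k *ᵥ fun e => J c (a, b, e)) d - ((X k)ᵀ *ᵥ fun e => J c (e, b, d)) a -
        ((X k)ᵀ *ᵥ fun e => J c (a, e, d)) b := by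
    have h := coboundaryMap_contraction (l k) c (u a) (u b)
    have h1 : J (D k c) (a, b, d) =
      u.repr ((coboundaryMap ℂ L (contraction (l k) c)).1 (u a) (u b)) d := rfl
    rw [h1, h, map_sub, map_sub, Finsupp.sub_apply, Finsupp.sub_apply, hX, hXu, hXu]
    simp only [map_sum, map_smul, LinearMap.sum_apply, LinearMap.smul_apply,
      Finsupp.finsetSum_apply, Finsupp.smul_apply]
    rfl
  have hskew (k : κ) (c c' : twoCocycle ℂ L L) :
      star (J (D k c)) ⬝ᵥ J c' = -(star (J c) ⬝ᵥ J (D k c')) := by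
    simp only [dotProduct, Fintype.sum_prod_type, Pi.star_apply, hJD, star_sub, sub_mul, mul_sub,
      Finset.sum_sub_distrib, neg_sub]
    have e1 (a b) := skew_dotProduct (hl k) (fun e => J c (a, b, e)) (fun e => J c' (a, b, e))
    have e2 (b d) := skew_dotProduct (hXT k) (fun e => J c (e, b, d)) (fun e => J c' (e, b, d))
    have e3 (a d) := skew_dotProduct (hXT k) (fun e => J c (a, e, d)) (fun e => J c' (a, e, d))
    simp only [dotProduct, Pi.star_apply] at e1 e2 e3
    have s1 {F H : m → m → m → ℂ} (h : ∀ a b, ∑ d, F a b d = -∑ d, H a b d) :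
        ∑ a, ∑ b, ∑ d, F a b d = -∑ a, ∑ b, ∑ d, H a b d := by
      simp only [h, Finset.sum_neg_distrib]
    have s3 {F H : m → m → m → ℂ} (h : ∀ a d, ∑ b, F a b d = -∑ b, H a b d) :
        ∑ a, ∑ b, ∑ d, F a b d = -∑ a, ∑ b, ∑ d, H a b d := by
      rw [Finset.sum_congr rfl fun a _ => Finset.sum_comm (f := F a),
        Finset.sum_congr rfl fun a _ => Finset.sum_comm (f := H a)]
      exact s1 (F := fun a d b => F a b d) (H := fun a d b => H a b d) h
    have s2 {F H : m → m → m → ℂ} (h : ∀ b d, ∑ a, F a b d = -∑ a, H a b d) :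
        ∑ a, ∑ b, ∑ d, F a b d = -∑ a, ∑ b, ∑ d, H a b d := by
      rw [Finset.sum_comm, Finset.sum_comm (f := fun a b => ∑ d, H a b d)]
      exact s3 (F := fun b a d => F a b d) (H := fun b a d => H a b d) h
    linear_combination s1 e1 - s2 e2 - s3 e3
  obtain ⟨c₀, w, h0, hw⟩ := exists_add_sum_sq_of_skew J hJ D hskew c
  refine ⟨c₀, ∑ k, contraction (l k) (D k w), fun x hx y z => ?_, ?_⟩
  · induction hx using Submodule.span_induction with
    | mem x hx =>
      obtain ⟨k, rfl⟩ := hx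
      have h := coboundaryMap_contraction (l k) c₀ y z
      have h1 : coboundaryMap ℂ L (contraction (l k) c₀) = 0 := h0 k
      rw [h1] at h
      rw [← sub_eq_zero, ← sub_sub, ← h]
      rfl
    | zero => simp
    | add x x' _ _ h h' =>
      simp only [add_lie, map_add, LinearMap.add_apply, h, h']
      abel
    | smul t x _ h => simp only [smul_lie, map_smul, LinearMap.smul_apply, h, smul_add]
  · rw [map_sum]
    exact hw

variable {n : ℕ}

instance : FiniteDimensional ℂ (Heisenberg ℂ n) :=
  Module.Finite.equiv (Heisenberg.toProd.linearEquiv ℂ).symm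

instance : FiniteDimensional ℂ (G ℂ n) :=
  Module.Finite.equiv (LieAlgebra.SemiDirectSum.toProdl (Heisenberg.action ℂ n)).symm

open scoped ComplexOrder in
/-- The Hermitian form on `g_n` which makes `e_1, …, e_{2n}, I` orthonormal and restricts to the
trace form on `o(n)`. -/
@[reducible] def hermitianCore (n : ℕ) : InnerProductSpace.Core ℂ (G ℂ n) where
  inner a b := star a.left.x ⬝ᵥ b.left.x + star a.left.p ⬝ᵥ b.left.p + star a.left.z * b.left.z +
    trace (a.right.1ᴴ * b.right.1)
  conj_inner_symm a b := by
    simp only [starRingEnd_apply, star_add, star_mul', star_star, ← trace_conjTranspose,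
      conjTranspose_mul, conjTranspose_conjTranspose, ← star_dotProduct_star]
    simp only [dotProduct_comm (star a.left.x), dotProduct_comm (star a.left.p), mul_comm]
  re_inner_nonneg a := by
    have h : 0 ≤ star a.left.x ⬝ᵥ a.left.x + star a.left.p ⬝ᵥ a.left.p +
        star a.left.z * a.left.z + trace (a.right.1ᴴ * a.right.1) :=
      add_nonneg (add_nonneg (add_nonneg (dotProduct_star_self_nonneg _)
        (dotProduct_star_self_nonneg _)) (star_mul_self_nonneg _))
        (posSemidef_conjTranspose_mul_self _).trace_nonneg
    exact (Complex.le_def.1 h).1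
  add_left a b c := by
    simp only [G.add_left, G.add_right, Heisenberg.add_x, Heisenberg.add_p, Heisenberg.add_z,
      star_add, add_dotProduct, add_mul]
    rw [show (↑(a.right + b.right) : Matrix (Fin n) (Fin n) ℂ) = a.right.1 + b.right.1 from rfl,
      conjTranspose_add, Matrix.add_mul, trace_add]
    ring
  smul_left a b r := by
    simp only [G.smul_left, G.smul_right, Heisenberg.smul_x, Heisenberg.smul_p, Heisenberg.smul_z,
      star_smul, smul_dotProduct, starRingEnd_apply, smul_eq_mul, star_mul']
    rw [show (↑(r • a.right) : Matrix (Fin n) (Fin n) ℂ) = r • a.right.1 from rfl,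
      conjTranspose_smul, Matrix.smul_mul, trace_smul, smul_eq_mul]
    ring
  definite a h := by
    have h1 := dotProduct_star_self_nonneg a.left.x
    have h2 := dotProduct_star_self_nonneg a.left.p
    have h3 := star_mul_self_nonneg a.left.z
    have h4 := (posSemidef_conjTranspose_mul_self a.right.1).trace_nonneg
    rw [add_eq_zero_iff_of_nonneg (add_nonneg (add_nonneg h1 h2) h3) h4,
      add_eq_zero_iff_of_nonneg (add_nonneg h1 h2) h3, add_eq_zero_iff_of_nonneg h1 h2] at h
    obtain ⟨⟨⟨hx, hp⟩, hz⟩, hr⟩ := h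
    refine G.ext_coords (dotProduct_star_self_eq_zero.1 hx) (dotProduct_star_self_eq_zero.1 hp) ?_
      (trace_conjTranspose_mul_self_eq_zero_iff.1 hr)
    simpa using hz

/-- The inclusion of `o(n)` into `g_n`. -/
abbrev G.rot {R : Type*} [CommRing R] (A : so (Fin n) R) : G R n := ⟨0, A⟩

/-- The expansion of a skew-symmetric matrix in the `l_{ij}`; every pair `i, j` is counted twice. -/
lemma two_smul_eq_sum_wedge {R : Type*} [CommRing R] (A : so (Fin n) R) :
    (2 : R) • A = ∑ i, ∑ j, A.1 j i • wedge (Pi.single i 1) (Pi.single j 1) := by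
  have hA (k l : Fin n) : A.1 l k = -A.1 k l := congrFun (congrFun (so_transpose A) k) l
  refine Subtype.ext ?_
  ext k l
  have h (i j : Fin n) : (A.1 j i • wedge (Pi.single i 1) (Pi.single j 1)).1 k l =
      A.1 j i * ((Pi.single j 1 : Fin n → R) k * (Pi.single i 1 : Fin n → R) l -
        (Pi.single i 1 : Fin n → R) k * (Pi.single j 1 : Fin n → R) l) := rfl
  have h2 : (∑ i, ∑ j, A.1 j i • wedge (Pi.single i 1) (Pi.single j 1 : Fin n → R)).1 k l =
      ∑ i, ∑ j, (A.1 j i • wedge (Pi.single i 1) (Pi.single j 1 : Fin n → R)).1 k l := by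
    simp only [AddSubmonoidClass.coe_finsetSum, Matrix.sum_apply]
  rw [h2]
  simp only [h, Pi.single_apply, mul_sub, Finset.sum_sub_distrib]
  simp [hA k l]
  ring

/-- The `l_{ij}` are real, hence skew-Hermitian. -/
lemma star_wedge_single (i j : Fin n) :
    ((wedge (Pi.single i 1) (Pi.single j 1) : so (Fin n) ℂ).1)ᴴ =
      -(wedge (Pi.single i 1) (Pi.single j 1) : so (Fin n) ℂ).1 := by
  have h (i : Fin n) : star (Pi.single i 1 : Fin n → ℂ) = Pi.single i 1 := by
    rw [← Pi.single_star, star_one]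
  simp [wedge, conjTranspose_vecMulVec, h]

/-- Real skew-symmetric matrices act on `g_n` by skew-Hermitian operators. -/
lemma hermitianCore_skew (A : so (Fin n) ℂ) (hA : A.1ᴴ = -A.1) (v w : G ℂ n) :
    (hermitianCore n).inner ⁅G.rot A, v⁆ w = -(hermitianCore n).inner v ⁅G.rot A, w⁆ := by
  change star ⁅G.rot A, v⁆.left.x ⬝ᵥ w.left.x + star ⁅G.rot A, v⁆.left.p ⬝ᵥ w.left.p +
      star ⁅G.rot A, v⁆.left.z * w.left.z + trace (⁅G.rot A, v⁆.right.1ᴴ * w.right.1) =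
    -(star v.left.x ⬝ᵥ ⁅G.rot A, w⁆.left.x + star v.left.p ⬝ᵥ ⁅G.rot A, w⁆.left.p +
      star v.left.z * ⁅G.rot A, w⁆.left.z + trace (v.right.1ᴴ * ⁅G.rot A, w⁆.right.1))
  simp only [G.lie_left_x, G.lie_left_p, G.lie_left_z, G.lie_right_val, Heisenberg.zero_x,
    Heisenberg.zero_p, mulVec_zero, sub_zero, skew_dotProduct hA, zero_dotProduct, dotProduct_zero,
    star_zero, zero_mul, mul_zero, conjTranspose_sub, conjTranspose_mul, hA, Matrix.mul_sub,
    Matrix.sub_mul, trace_sub, Matrix.mul_neg, Matrix.neg_mul, trace_neg]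
  have h := trace_mul_comm A.1 (v.right.1ᴴ * w.right.1)
  simp only [Matrix.mul_assoc] at *
  linear_combination h

lemma rot_mem_span (A : so (Fin n) ℂ) : G.rot A ∈ Submodule.span ℂ (Set.range
    fun ij : Fin n × Fin n => (G.rot (wedge (Pi.single ij.1 1) (Pi.single ij.2 1)) : G ℂ n)) := by
  have h : (2 : ℂ) • G.rot A = ∑ i, ∑ j, A.1 j i •
      (G.rot (wedge (Pi.single i 1) (Pi.single j 1)) : G ℂ n) := by
    have := congrArg (LieAlgebra.SemiDirectSum.inr (Heisenberg.action ℂ n))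
      (two_smul_eq_sum_wedge A)
    rw [map_smul, map_sum] at this
    refine this.trans (Finset.sum_congr rfl fun i _ => ?_)
    rw [map_sum]
    refine Finset.sum_congr rfl fun j _ => ?_
    rw [map_smul]
    rfl
  rw [← Submodule.smul_mem_iff _ (two_ne_zero (α := ℂ)), h]
  exact Submodule.sum_mem _ fun i _ => Submodule.sum_mem _ fun j _ =>
    Submodule.smul_mem _ _ (Submodule.subset_span ⟨(i, j), rfl⟩)

lemma exists_basis_ad_skew : ∃ u : Module.Basis (Fin (Module.finrank ℂ (G ℂ n))) ℂ (G ℂ n),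
    ∀ ij : Fin n × Fin n, (LinearMap.toMatrix u u (LieAlgebra.ad ℂ (G ℂ n)
        (G.rot (wedge (Pi.single ij.1 1) (Pi.single ij.2 1)))))ᴴ =
      -LinearMap.toMatrix u u (LieAlgebra.ad ℂ (G ℂ n)
        (G.rot (wedge (Pi.single ij.1 1) (Pi.single ij.2 1)))) := by
  obtain ⟨u, hu⟩ := exists_basis_skew (hermitianCore n)
  refine ⟨u, fun ij => ?_⟩
  exact hu (LieAlgebra.ad ℂ (G ℂ n) (G.rot (wedge (Pi.single ij.1 1) (Pi.single ij.2 1))))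
    (hermitianCore_skew _ (star_wedge_single _ _))

/-- Every 2-cocycle of `g_n` is cohomologous to an `o(n)`-invariant one. -/
theorem exists_so_invariant_cocycle (c : Z2 ℂ (G ℂ n)) :
    ∃ (c₀ : Z2 ℂ (G ℂ n)) (τ : G ℂ n →ₗ[ℂ] G ℂ n),
      (∀ A : so (Fin n) ℂ, InvariantUnder (G.rot A) c₀.1) ∧ c = c₀ + coboundaryMap ℂ (G ℂ n) τ := by
  obtain ⟨u, hu⟩ := exists_basis_ad_skew (n := n)
  have key := exists_span_invariant_cocycle u _ hu c
  clear hu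
  obtain ⟨c₀, τ, h, hc⟩ := key
  exact ⟨c₀, τ, fun A => h _ (rot_mem_span A), hc⟩

end Averaging

/-! ### Brackets of the basis elements of `g_n` -/

section Basis

variable {n : ℕ}

namespace G

/-- The inclusion `u ↦ ∑ i, u i • e_i`. -/
def ex : (Fin n → ℂ) →ₗ[ℂ] G ℂ n where
  toFun u := ⟨⟨u, 0, 0⟩, 0⟩
  map_add' u v := by ext <;> simp
  map_smul' c u := by ext <;> simp

/-- The inclusion `u ↦ ∑ i, u i • e_{n+i}`. -/
def ep : (Fin n → ℂ) →ₗ[ℂ] G ℂ n where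
  toFun u := ⟨⟨0, u, 0⟩, 0⟩
  map_add' u v := by ext <;> simp
  map_smul' c u := by ext <;> simp

/-- The inclusion of `o(n)` into `g_n`, as a linear map. -/
def rotL : so (Fin n) ℂ →ₗ[ℂ] G ℂ n where
  toFun := G.rot
  map_add' u v := by ext <;> simp
  map_smul' c u := by ext <;> simp

/-- The central element `I`. -/
def I : G ℂ n := ⟨⟨0, 0, 1⟩, 0⟩

/-- The coordinates along `e_1, …, e_n`. -/
def xL : G ℂ n →ₗ[ℂ] (Fin n → ℂ) where
  toFun a := a.left.x
  map_add' _ _ := rfl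
  map_smul' _ _ := rfl

/-- The coordinates along `e_{n+1}, …, e_{2n}`. -/
def pL : G ℂ n →ₗ[ℂ] (Fin n → ℂ) where
  toFun a := a.left.p
  map_add' _ _ := rfl
  map_smul' _ _ := rfl

/-- The coordinate along `I`. -/
def zL : G ℂ n →ₗ[ℂ] ℂ where
  toFun a := a.left.z
  map_add' _ _ := rfl
  map_smul' _ _ := rfl

/-- The projection to `o(n)`. -/
def rL : G ℂ n →ₗ[ℂ] so (Fin n) ℂ where
  toFun a := a.right
  map_add' _ _ := rfl
  map_smul' _ _ := rfl

lemma decompose (a : G ℂ n) :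
    a = ex a.left.x + ep a.left.p + a.left.z • I + G.rot a.right := by
  refine ext_coords ?_ ?_ ?_ ?_ <;>
    simp [ex, ep, I]

lemma lie_I (a : G ℂ n) : ⁅a, (I : G ℂ n)⁆ = 0 := by
  refine ext_coords ?_ ?_ ?_ ?_ <;>
    simp only [lie_left_x, lie_left_p, lie_left_z, lie_right_val] <;> simp [I]

lemma I_lie (a : G ℂ n) : ⁅(I : G ℂ n), a⁆ = 0 := by
  rw [← lie_skew, lie_I, neg_zero]

lemma rot_lie_ex (A : so (Fin n) ℂ) (u : Fin n → ℂ) : ⁅G.rot A, ex u⁆ = ex (A.1 *ᵥ u) := by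
  refine ext_coords ?_ ?_ ?_ ?_ <;>
    simp only [lie_left_x, lie_left_p, lie_left_z, lie_right_val] <;> simp [ex]

lemma rot_lie_ep (A : so (Fin n) ℂ) (u : Fin n → ℂ) : ⁅G.rot A, ep u⁆ = ep (A.1 *ᵥ u) := by
  refine ext_coords ?_ ?_ ?_ ?_ <;>
    simp only [lie_left_x, lie_left_p, lie_left_z, lie_right_val] <;> simp [ep]

lemma rot_lie_rot (A B : so (Fin n) ℂ) : ⁅(G.rot A : G ℂ n), G.rot B⁆ = G.rot ⁅A, B⁆ := by
  refine ext_coords ?_ ?_ ?_ ?_ <;>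
    simp only [lie_left_x, lie_left_p, lie_left_z, lie_right_val] <;> simp [Ring.lie_def]

lemma ex_lie_ex (u v : Fin n → ℂ) : ⁅(ex u : G ℂ n), ex v⁆ = 0 := by
  refine ext_coords ?_ ?_ ?_ ?_ <;>
    simp only [lie_left_x, lie_left_p, lie_left_z, lie_right_val] <;> simp [ex]

lemma ep_lie_ep (u v : Fin n → ℂ) : ⁅(ep u : G ℂ n), ep v⁆ = 0 := by
  refine ext_coords ?_ ?_ ?_ ?_ <;>
    simp only [lie_left_x, lie_left_p, lie_left_z, lie_right_val] <;> simp [ep]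

lemma ex_lie_ep (u v : Fin n → ℂ) : ⁅(ex u : G ℂ n), ep v⁆ = (u ⬝ᵥ v) • I := by
  refine ext_coords ?_ ?_ ?_ ?_ <;>
    simp only [lie_left_x, lie_left_p, lie_left_z, lie_right_val] <;> simp [ex, ep, I]

/-- The centre of `g_n` is spanned by `I`. -/
lemma eq_of_forall_lie_eq {a b : G ℂ n} (h : ∀ y : G ℂ n, ⁅a, y⁆ = ⁅b, y⁆)
    (hz : a.left.z = b.left.z) :
    a = b := by
  have hx (v : Fin n → ℂ) := h (ex v)
  have hp (v : Fin n → ℂ) := h (ep v)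
  refine ext_coords ?_ ?_ hz ?_
  · refine dotProduct_eq _ _ fun v => ?_
    simpa only [lie_left_z, ex, ep, LinearMap.coe_mk, AddHom.coe_mk, zero_dotProduct, sub_zero]
      using congrArg (fun a => a.left.z) (hp v)
  · refine dotProduct_eq _ _ fun v => ?_
    simpa only [lie_left_z, ex, ep, LinearMap.coe_mk, AddHom.coe_mk, dotProduct_zero, zero_sub,
      neg_inj, dotProduct_comm v] using congrArg (fun a => a.left.z) (hx v)
  · refine ext_of_mulVec_single fun j => ?_
    simpa only [lie_left_x, ex, ep, LinearMap.coe_mk, AddHom.coe_mk, ZeroMemClass.coe_zero,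
      zero_mulVec, sub_zero] using congrArg (fun a => a.left.x) (hx (Pi.single j 1))

end G

end Basis

/-! ### Cocycles that vanish on `o(n)` -/

section KillRotations

variable {n : ℕ}

/-- If a cocycle is invariant under `x` and `y`, then its contraction with `⁅x, y⁆` is an inner
derivation. -/
lemma apply_lie_of_invariant {R L : Type*} [CommRing R] [LieRing L] [LieAlgebra R L]
    {c : twoCochain R L L} (hc : c ∈ twoCocycle R L L) {x y : L} (hx : InvariantUnder x c)
    (hy : InvariantUnder y c) (w : L) : c ⁅x, y⁆ w = ⁅c x y, w⁆ := by
  have h := twoCocycle_apply_eq hc x y w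
  rw [hx y w, hy x w, ← lie_skew y x, map_neg, LinearMap.neg_apply, ← twoCochain_skew c y ⁅x, w⁆,
    ← twoCochain_skew c x ⁅y, w⁆] at h
  rw [← lie_skew _ w, ← sub_eq_zero, ← h]
  abel

/-- For `n ≠ 2` this writes each `wedge u v` as a sum of commutators. -/
lemma sum_lie_wedge {R : Type*} [CommRing R] (u v : Fin n → R) :
    ∑ i, ⁅wedge (Pi.single i 1) u, wedge (Pi.single i 1) v⁆ = ((n : R) - 2) • wedge u v := by
  have h (i : Fin n) : ⁅wedge (Pi.single i 1) u, wedge (Pi.single i 1) v⁆ =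
      wedge u v - wedge (Pi.single i (u i)) v + wedge (Pi.single i (v i)) u := by
    rw [so_lie_wedge, wedge_mulVec, wedge_mulVec, wedge_sub_left, wedge_sub_right,
      wedge_smul_left, wedge_smul_left, wedge_smul_right, wedge_smul_right, wedge_self]
    have e (t : R) : (Pi.single i t : Fin n → R) = t • Pi.single i 1 := by
      rw [← Pi.single_smul, smul_eq_mul, mul_one]
    rw [e (u i), e (v i), wedge_smul_left, wedge_smul_left]
    simp
  have hs (u v : Fin n → R) : ∑ i, wedge (Pi.single i (u i)) v = wedge u v := by
    have : wedge (∑ i, Pi.single i (u i)) v = ∑ i, wedge (Pi.single i (u i)) v :=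
      map_sum (AddMonoidHom.mk' (fun u => wedge u v) fun _ _ => wedge_add_left _ _ _) _ _
    rw [← this, Finset.univ_sum_single]
  simp only [h, Finset.sum_add_distrib, Finset.sum_sub_distrib, hs, Finset.sum_const,
    Finset.card_univ, Fintype.card_fin, ← Nat.cast_smul_eq_nsmul R]
  rw [wedge_swap v u]
  module

/-- The contraction of an invariant cocycle with a rotation is an inner derivation, because `o(n)`
is perfect; the elements inducing these derivations can be chosen to depend linearly on the
rotation. -/
lemma exists_apply_rot_eq_lie (hn : 3 ≤ n) {c : twoCochain ℂ (G ℂ n) (G ℂ n)}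
    (hc : c ∈ Z2 ℂ (G ℂ n)) (hinv : ∀ A : so (Fin n) ℂ, InvariantUnder (G.rot A) c) :
    ∃ β : so (Fin n) ℂ →ₗ[ℂ] G ℂ n, ∀ A y, c (G.rot A) y = ⁅β A, y⁆ := by
  have h1 (u v : Fin n → ℂ) : ∃ w : G ℂ n, ∀ y, c (G.rot (wedge u v)) y = ⁅w, y⁆ := by
    refine ⟨((n : ℂ) - 2)⁻¹ • ∑ i, c (G.rot (wedge (Pi.single i 1) u))
      (G.rot (wedge (Pi.single i 1) v)), fun y => ?_⟩
    have hn' : (n : ℂ) - 2 ≠ 0 := by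
      rw [sub_ne_zero]
      exact_mod_cast (show n ≠ 2 by omega)
    have hw : (G.rot (wedge u v) : G ℂ n) = ((n : ℂ) - 2)⁻¹ • ∑ i,
        ⁅(G.rot (wedge (Pi.single i 1) u) : G ℂ n), G.rot (wedge (Pi.single i 1) v)⁆ := by
      rw [eq_inv_smul_iff₀ hn']
      simp only [G.rot_lie_rot]
      have := congrArg G.rotL (sum_lie_wedge u v)
      rw [map_sum, map_smul] at this
      exact this.symm
    rw [hw, map_smul, map_sum, LinearMap.smul_apply, LinearMap.sum_apply, smul_lie, sum_lie]
    refine congrArg _ (Finset.sum_congr rfl fun i _ => ?_)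
    exact apply_lie_of_invariant hc (hinv _) (hinv _) y
  have h2 (x : G ℂ n) (hx : x ∈ Submodule.span ℂ (Set.range fun ij : Fin n × Fin n =>
      (G.rot (wedge (Pi.single ij.1 1) (Pi.single ij.2 1)) : G ℂ n))) :
      ∃ w : G ℂ n, ∀ y, c x y = ⁅w, y⁆ := by
    induction hx using Submodule.span_induction with
    | mem x hx =>
      obtain ⟨ij, rfl⟩ := hx
      exact h1 _ _
    | zero => exact ⟨0, fun y => by rw [map_zero, LinearMap.zero_apply, zero_lie]⟩
    | add x x' _ _ h h' =>
      obtain ⟨w, hw⟩ := h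
      obtain ⟨w', hw'⟩ := h'
      exact ⟨w + w', fun y => by rw [map_add, LinearMap.add_apply, add_lie, hw, hw']⟩
    | smul t x _ h =>
      obtain ⟨w, hw⟩ := h
      exact ⟨t • w, fun y => by rw [map_smul, LinearMap.smul_apply, smul_lie, hw]⟩
  let ad : G ℂ n →ₗ[ℂ] (G ℂ n →ₗ[ℂ] G ℂ n) := (bracketCochain ℂ (G ℂ n)).1
  obtain ⟨β, hβ⟩ := Module.projective_lifting_property ad.rangeRestrict
    ((c.1 ∘ₗ G.rotL).codRestrict (LinearMap.range ad) fun A => by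
      obtain ⟨w, hw⟩ := h2 _ (rot_mem_span A)
      exact ⟨w, LinearMap.ext fun y => (hw y).symm⟩) ad.surjective_rangeRestrict
  exact ⟨β, fun A y =>
    (LinearMap.congr_fun (congrArg Subtype.val (LinearMap.congr_fun hβ A)) y).symm⟩

/-- The projection of `g_n` along its centre. -/
def killCentre : G ℂ n →ₗ[ℂ] G ℂ n where
  toFun a := ⟨⟨a.left.x, a.left.p, 0⟩, a.right⟩
  map_add' a b := by ext <;> simp
  map_smul' c a := by ext <;> simp

lemma killCentre_lie (a y : G ℂ n) : ⁅killCentre a, y⁆ = ⁅a, y⁆ := by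
  refine G.ext_coords ?_ ?_ ?_ ?_ <;>
    simp only [G.lie_left_x, G.lie_left_p, G.lie_left_z, G.lie_right_val] <;> rfl

lemma coboundaryMap_apply (τ : G ℂ n →ₗ[ℂ] G ℂ n) (y z : G ℂ n) :
    (coboundaryMap ℂ (G ℂ n) τ).1 y z = ⁅y, τ z⁆ - ⁅z, τ y⁆ - τ ⁅y, z⁆ := rfl

lemma eq_sub_coboundaryMap_add {R L : Type*} [CommRing R] [LieRing L] [LieAlgebra R L]
    {c c₁ : Z2 R L} {τ₁ : L →ₗ[R] L} (h : c = c₁ + coboundaryMap R L τ₁) (τ : L →ₗ[R] L) :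
    c = (c₁ - coboundaryMap R L τ) + coboundaryMap R L (τ + τ₁) := by
  rw [h, map_add]
  abel

lemma sub_coboundaryMap_apply {R L : Type*} [CommRing R] [LieRing L] [LieAlgebra R L]
    (c : Z2 R L) (τ : L →ₗ[R] L) (y z : L) :
    (c - coboundaryMap R L τ).1 y z = c.1 y z - (⁅y, τ z⁆ - ⁅z, τ y⁆ - τ ⁅y, z⁆) := rfl

/-- The elements `β A` inducing the contractions with the rotations are determined up to the centre.
Taking them without central component makes `β` equivariant. -/
lemma exists_equivariant_apply_rot_eq_lie (hn : 3 ≤ n) {c : twoCochain ℂ (G ℂ n) (G ℂ n)}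
    (hc : c ∈ Z2 ℂ (G ℂ n)) (hinv : ∀ A : so (Fin n) ℂ, InvariantUnder (G.rot A) c) :
    ∃ β : so (Fin n) ℂ →ₗ[ℂ] G ℂ n, (∀ A y, c (G.rot A) y = ⁅β A, y⁆) ∧
      ∀ A B, β ⁅A, B⁆ = ⁅(G.rot A : G ℂ n), β B⁆ := by
  obtain ⟨β₀, hβ₀⟩ := exists_apply_rot_eq_lie hn hc hinv
  let β := killCentre ∘ₗ β₀
  have hβ (A y) : c (G.rot A) y = ⁅β A, y⁆ := (hβ₀ A y).trans (killCentre_lie _ _).symm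
  have hz (A) : (β A).left.z = 0 := rfl
  refine ⟨β, hβ, fun A B => ?_⟩
  refine G.eq_of_forall_lie_eq (fun y => ?_) ?_
  · rw [← hβ, ← G.rot_lie_rot, apply_lie_of_invariant hc (hinv A) (hinv B),
      ← twoCochain_skew, hβ, lie_skew]
  · rw [hz, G.lie_left_z]
    simp

/-- Every 2-cocycle of `g_n` is cohomologous to one that vanishes on `o(n)`. -/
theorem exists_cocycle_vanishing_on_rot (hn : 3 ≤ n) (c : Z2 ℂ (G ℂ n)) :
    ∃ (c₀ : Z2 ℂ (G ℂ n)) (τ : G ℂ n →ₗ[ℂ] G ℂ n),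
      (∀ (A : so (Fin n) ℂ) (y), c₀.1 (G.rot A) y = 0) ∧ c = c₀ + coboundaryMap ℂ (G ℂ n) τ := by
  have key := exists_so_invariant_cocycle c
  obtain ⟨c₁, τ₁, hinv, hc⟩ := key
  have key := exists_equivariant_apply_rot_eq_lie hn c₁.2 hinv
  clear hinv
  obtain ⟨β, hβ, heq⟩ := key
  refine ⟨_, _, fun A y => ?_, eq_sub_coboundaryMap_add hc (β ∘ₗ G.rL)⟩
  clear hc
  -- By equivariance the coboundary of `β`, extended by zero to the Heisenberg algebra, agrees with
  -- `c₁` on `o(n)`.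
  have hτ (a : G ℂ n) : (β ∘ₗ G.rL) a = β a.right := rfl
  rw [sub_coboundaryMap_apply, hβ, hτ, hτ, hτ, G.lie_right, heq, ← lie_skew y]
  abel

end KillRotations

/-! ### Linear families of Lie brackets -/

section LinearFamily

variable {L : Type*} [LieRing L] [LieAlgebra ℂ L]

lemma lie_lie_cyclic_sum {L : Type*} [LieRing L] (x y z : L) :
    ⁅⁅x, y⁆, z⁆ + ⁅⁅y, z⁆, x⁆ + ⁅⁅z, x⁆, y⁆ = 0 := by
  rw [← neg_eq_zero, ← lie_jacobi x y z, ← lie_skew ⁅x, y⁆, ← lie_skew ⁅y, z⁆, ← lie_skew ⁅z, x⁆]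
  abel

/-- The Jacobi identity for `[·,·] + F`, sorted by degree in `F`. -/
lemma jacobi_add_expand {F : twoCochain ℂ L L} (h : Jacobi (bracketCochain ℂ L + F)) (x y z : L) :
    (⁅F x y, z⁆ + ⁅F y z, x⁆ + ⁅F z x, y⁆ + (F ⁅x, y⁆ z + F ⁅y, z⁆ x + F ⁅z, x⁆ y)) +
      (F (F x y) z + F (F y z) x + F (F z x) y) = 0 := by
  have e (a b : L) : (bracketCochain ℂ L + F) a b = ⁅a, b⁆ + F a b := rfl
  have h1 := h x y z
  simp only [e, map_add, LinearMap.add_apply] at h1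
  refine Eq.trans ?_ ((congrArg₂ (· - ·) h1 (lie_lie_cyclic_sum x y z)).trans (sub_zero 0))
  abel

/-- If `[·,·] + F` and `[·,·] - F` both satisfy the Jacobi identity, then the terms of the Jacobi
identity for `[·,·] + tF` that are linear, respectively quadratic, in `t` vanish. -/
lemma linear_and_quadratic_of_jacobi {F : twoCochain ℂ L L}
    (h : Jacobi (bracketCochain ℂ L + F)) (h' : Jacobi (bracketCochain ℂ L + -F)) (x y z : L) :
    ⁅F x y, z⁆ + ⁅F y z, x⁆ + ⁅F z x, y⁆ + (F ⁅x, y⁆ z + F ⁅y, z⁆ x + F ⁅z, x⁆ y) = 0 ∧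
      F (F x y) z + F (F y z) x + F (F z x) y = 0 := by
  have e (a b : L) : (-F) a b = -F a b := rfl
  have h1 := jacobi_add_expand h x y z
  have h2 := jacobi_add_expand h' x y z
  simp only [e, map_neg, neg_lie, LinearMap.neg_apply, neg_neg] at h2
  constructor
  · refine (smul_eq_zero.1 ?_).resolve_left (two_ne_zero : (2 : ℂ) ≠ 0)
    rw [← sub_self (0 : L)]
    nth_rewrite 1 [← h1]
    rw [← h2]
    module
  · refine (smul_eq_zero.1 ?_).resolve_left (two_ne_zero : (2 : ℂ) ≠ 0)
    rw [← add_zero (0 : L)]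
    nth_rewrite 1 [← h1]
    rw [← h2]
    module

lemma mem_twoCocycle_of_jacobi {F : twoCochain ℂ L L} (h : Jacobi (bracketCochain ℂ L + F))
    (h' : Jacobi (bracketCochain ℂ L + -F)) : F ∈ Z2 ℂ L := by
  rw [mem_twoCocycle_iff]
  refine LinearMap.ext fun x => LinearMap.ext fun y => LinearMap.ext fun z => ?_
  rw [d₂₃_apply]
  change _ = (0 : L)
  rw [← neg_eq_zero, ← (linear_and_quadratic_of_jacobi h h' x y z).1, ← lie_skew x (F y z),
    ← lie_skew z (F x y), ← lie_skew y (F x z), ← twoCochain_skew F z x, ← lie_skew z x, map_neg,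
    LinearMap.neg_apply, neg_lie]
  abel

/-- The linear family `[·,·] + tF` is a formal deformation if it satisfies the Jacobi identity
for `t = 1` and `t = -1`. -/
lemma isFormalDeformation_of_jacobi {φ : ℕ → twoCochain ℂ L L} (h0 : φ 0 = bracketCochain ℂ L)
    (hφ : ∀ k, φ (k + 2) = 0) (h : Jacobi (bracketCochain ℂ L + φ 1))
    (h' : Jacobi (bracketCochain ℂ L + -φ 1)) : IsFormalDeformation φ := by
  have e (a b : L) : φ 0 a b = ⁅a, b⁆ := by rw [h0]; rfl
  have hz (k : ℕ) (a b : L) : φ (k + 2) a b = 0 := by rw [hφ]; rfl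
  refine ⟨h0, fun k x y z => ?_⟩
  match k with
  | 0 =>
    simp only [Finset.Nat.antidiagonal_zero, Finset.sum_singleton, e]
    exact lie_lie_cyclic_sum x y z
  | 1 =>
    rw [← (linear_and_quadratic_of_jacobi h h' x y z).1]
    simp only [Finset.Nat.sum_antidiagonal_succ, Finset.Nat.antidiagonal_zero, Finset.sum_singleton,
      zero_add, e]
  | 2 =>
    rw [← (linear_and_quadratic_of_jacobi h h' x y z).2]
    simp only [Finset.Nat.sum_antidiagonal_succ, Finset.Nat.antidiagonal_zero, Finset.sum_singleton,
      zero_add, e, Nat.reduceAdd, hz 0, zero_lie, add_zero]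
  | k + 3 =>
    refine Finset.sum_eq_zero fun ij hij => ?_
    rw [Finset.HasAntidiagonal.mem_antidiagonal] at hij
    obtain ⟨i, j⟩ := ij
    obtain hi | hj : 2 ≤ i ∨ 2 ≤ j := by
      simp only at hij
      omega
    · obtain ⟨i, rfl⟩ := Nat.exists_eq_add_of_le' hi
      simp only [hz, add_zero]
    · obtain ⟨j, rfl⟩ := Nat.exists_eq_add_of_le' hj
      simp only [hz, add_zero, map_zero, LinearMap.zero_apply]

end LinearFamily

/-! ### The cocycles `f₁, f₂, f₃` and their independence -/

section Family

variable {n : ℕ}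

lemma jacobi_add_sum (ε : Fin 3 → ℂ) :
    Jacobi (bracketCochain ℂ (G ℂ n) + ∑ i, ε i • f ℂ n i) := jacobi_deformedBracket ε

lemma jacobi_add_neg_sum (ε : Fin 3 → ℂ) :
    Jacobi (bracketCochain ℂ (G ℂ n) + -∑ i, ε i • f ℂ n i) := by
  have h := jacobi_deformedBracket (R := ℂ) (n := n) (-ε)
  have e : ∑ i, (-ε) i • f ℂ n i = -∑ i, ε i • f ℂ n i := by
    simp only [Pi.neg_apply, neg_smul, Finset.sum_neg_distrib]
  rw [deformedBracket, e] at h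
  exact h

lemma sum_f_mem (ε : Fin 3 → ℂ) : ∑ i, ε i • f ℂ n i ∈ Z2 ℂ (G ℂ n) :=
  mem_twoCocycle_of_jacobi (jacobi_add_sum ε) (jacobi_add_neg_sum ε)

lemma isFormalDeformation_deformedFamily (ε : Fin 3 → ℂ) :
    IsFormalDeformation (deformedFamily n ε) :=
  isFormalDeformation_of_jacobi rfl (fun _ => rfl) (jacobi_add_sum ε) (jacobi_add_neg_sum ε)

lemma f_mem (i : Fin 3) : f ℂ n i ∈ Z2 ℂ (G ℂ n) := by
  have h := sum_f_mem (n := n) (Pi.single i 1)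
  have e : ∑ j, (Pi.single i 1 : Fin 3 → ℂ) j • f ℂ n j = f ℂ n i := by
    rw [Finset.sum_eq_single i (fun j _ hj => by rw [Pi.single_eq_of_ne hj, zero_smul]) (by simp),
      Pi.single_eq_same, one_smul]
  rwa [e] at h

variable (n) in
/-- The cocycle `f i`. -/
def fCocycle (i : Fin 3) : Z2 ℂ (G ℂ n) := ⟨f ℂ n i, f_mem i⟩

lemma sum_fCocycle_apply (ε : Fin 3 → ℂ) (a b : G ℂ n) :
    (∑ i, ε i • fCocycle n i).1 a b =
      ε 0 • f₁ ℂ n a b + ε 1 • f₂ ℂ n a b + ε 2 • f₃ ℂ n a b := by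
  rw [Fin.sum_univ_three]
  rfl

lemma sum_smul_cocycle_val {R L : Type*} [CommRing R] [LieRing L] [LieAlgebra R L]
    (ε : Fin 3 → R) (g : Fin 3 → Z2 R L) : (∑ i, ε i • g i).1 = ∑ i, ε i • (g i).1 := by
  rw [Fin.sum_univ_three, Fin.sum_univ_three]
  rfl

lemma sum_fCocycle_val (ε : Fin 3 → ℂ) :
    (∑ i, ε i • fCocycle n i).1 = ∑ i, ε i • f ℂ n i :=
  sum_smul_cocycle_val ε _

lemma sum_f_rot (ε : Fin 3 → ℂ) (A : so (Fin n) ℂ) (y : G ℂ n) :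
    (∑ i, ε i • fCocycle n i).1 (G.rot A) y = 0 := by
  rw [sum_fCocycle_apply]
  refine G.ext_coords ?_ ?_ ?_ ?_ <;>
    simp [f₁_apply, f₂_apply, f₃_apply, wedge]

lemma sum_f_I_ex (ε : Fin 3 → ℂ) (u : Fin n → ℂ) :
    (∑ i, ε i • fCocycle n i).1 G.I (G.ex u) = ε 0 • G.ep u - ε 2 • G.ex u := by
  rw [sum_fCocycle_apply]
  refine G.ext_coords ?_ ?_ ?_ ?_ <;>
    simp [f₁_apply, f₂_apply, f₃_apply, wedge, G.I, G.ex, G.ep]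

lemma sum_f_I_ep (ε : Fin 3 → ℂ) (u : Fin n → ℂ) :
    (∑ i, ε i • fCocycle n i).1 G.I (G.ep u) = ε 2 • G.ep u - ε 1 • G.ex u := by
  rw [sum_fCocycle_apply]
  refine G.ext_coords ?_ ?_ ?_ ?_ <;>
    simp [f₁_apply, f₂_apply, f₃_apply, wedge, G.I, G.ex, G.ep]

/-- The cocycles `f₁, f₂, f₃` are linearly independent modulo coboundaries: a coboundary `d τ`
sends `(I, y)` to `-⁅y, τ I⁆`, so it acts on `e_i` and `e_{n+i}` through a skew-symmetric matrix. -/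
theorem eq_zero_of_sum_eq_coboundary (hn : 3 ≤ n) {ε : Fin 3 → ℂ} {τ : G ℂ n →ₗ[ℂ] G ℂ n}
    (h : ∑ i, ε i • fCocycle n i = coboundaryMap ℂ (G ℂ n) τ) : ε = 0 := by
  have key (y : G ℂ n) : (∑ i, ε i • fCocycle n i).1 G.I y = ⁅τ G.I, y⁆ := by
    rw [h, coboundaryMap_apply, G.I_lie, G.I_lie, map_zero, ← lie_skew y]
    abel
  clear h
  let i : Fin n := ⟨0, by omega⟩
  have hx := key (G.ex (Pi.single i 1))
  have hp := key (G.ep (Pi.single i 1))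
  rw [sum_f_I_ex] at hx
  rw [sum_f_I_ep] at hp
  have hd : (τ G.I).right.1 i i = 0 := by
    have := congrFun (congrFun (so_transpose (τ G.I).right) i) i
    rw [transpose_apply, Matrix.neg_apply] at this
    exact self_eq_neg.1 this
  have h0 := congrFun (congrArg (fun a => a.left.p) hx) i
  have h2 := congrFun (congrArg (fun a => a.left.x) hx) i
  have h1 := congrFun (congrArg (fun a => a.left.x) hp) i
  rw [G.lie_left_p] at h0
  rw [G.lie_left_x] at h1 h2
  simp [G.ex, G.ep, hd] at h0 h1 h2
  ext j
  fin_cases j <;> simp [h0, h1, h2]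

end Family

/-! ### Invariant theory of the standard representation of `o(n)` -/

section Invariants

variable {n : ℕ}

lemma exists_ne_ne (hn : 3 ≤ n) (a b : Fin n) : ∃ i, i ≠ a ∧ i ≠ b := by
  have h : ({a, b} : Finset (Fin n)).card < Fintype.card (Fin n) := by
    rw [Fintype.card_fin]
    exact (Finset.card_le_two).trans_lt (by omega)
  obtain ⟨i, hi⟩ := Finset.exists_mem_notMem_of_card_lt_card (t := Finset.univ) h
  simp only [Finset.mem_univ, Finset.mem_insert, Finset.mem_singleton, true_and, not_or] at hi
  exact ⟨i, hi⟩

lemma wedge_single_mulVec_single (i j a : Fin n) :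
    (wedge (Pi.single i 1) (Pi.single j 1) : so (Fin n) ℂ).1 *ᵥ Pi.single a 1 =
      (if i = a then 1 else 0 : ℂ) • Pi.single j 1 -
        (if j = a then 1 else 0 : ℂ) • Pi.single i 1 := by
  rw [wedge_mulVec]
  simp [Pi.single_apply, eq_comm]

/-- The standard representation of `o(n)` has no invariant functionals. -/
lemma invariant_functional_eq_zero (hn : 3 ≤ n) {l : (Fin n → ℂ) →ₗ[ℂ] ℂ}
    (h : ∀ (A : so (Fin n) ℂ) a, l (A.1 *ᵥ a) = 0) : l = 0 := by
  refine (Pi.basisFun ℂ (Fin n)).ext fun j => ?_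
  obtain ⟨i, hi, -⟩ := exists_ne_ne hn j j
  have h1 := h (wedge (Pi.single i 1) (Pi.single j 1)) (Pi.single i 1)
  rw [wedge_single_mulVec_single, if_pos rfl, if_neg hi.symm, one_smul, zero_smul, sub_zero] at h1
  rw [Pi.basisFun_apply, h1, LinearMap.zero_apply]

/-- The invariant bilinear forms on the standard representation of `o(n)` are the multiples of the
dot product. -/
lemma exists_eq_smul_dotProduct (hn : 3 ≤ n) {B : (Fin n → ℂ) →ₗ[ℂ] (Fin n → ℂ) →ₗ[ℂ] ℂ}
    (h : ∀ (A : so (Fin n) ℂ) a b, B (A.1 *ᵥ a) b + B a (A.1 *ᵥ b) = 0) :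
    ∃ κ : ℂ, ∀ a b, B a b = κ * (a ⬝ᵥ b) := by
  let T (a b : Fin n) : ℂ := B (Pi.single a 1) (Pi.single b 1)
  have hT (i j a b : Fin n) :
      (if i = a then 1 else 0) * T j b - (if j = a then 1 else 0) * T i b +
        ((if i = b then 1 else 0) * T a j - (if j = b then 1 else 0) * T a i) = 0 := by
    have := h (wedge (Pi.single i 1) (Pi.single j 1)) (Pi.single a 1) (Pi.single b 1)
    simpa only [wedge_single_mulVec_single, map_sub, map_smul, LinearMap.sub_apply,
      LinearMap.smul_apply, smul_eq_mul] using this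
  have hoff (j b : Fin n) (hjb : j ≠ b) : T j b = 0 := by
    obtain ⟨a, ha, hb⟩ := exists_ne_ne hn j b
    simpa [ha, hb, ha.symm, hjb] using hT a j a b
  have hdiag (i j : Fin n) : T i i = T j j := by
    by_cases hij : i = j
    · rw [hij]
    · have := hT i j i j
      simp [hij, Ne.symm hij] at this
      exact (sub_eq_zero.1 (by linear_combination this) : T j j = T i i).symm
  let o : Fin n := ⟨0, by omega⟩
  refine ⟨T o o, fun a b => ?_⟩
  have he : B = T o o • dotProductBilin ℂ ℂ := by
    refine (Pi.basisFun ℂ (Fin n)).ext fun i => (Pi.basisFun ℂ (Fin n)).ext fun j => ?_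
    rw [Pi.basisFun_apply, Pi.basisFun_apply]
    change T i j = T o o * (Pi.single i 1 ⬝ᵥ Pi.single j 1)
    rw [single_dotProduct, one_mul, Pi.single_apply]
    split_ifs with hij
    · rw [hij, mul_one, hdiag]
    · rw [hoff _ _ hij, mul_zero]
  rw [he]
  rfl

/-- Equivariant endomorphisms of the standard representation of `o(n)` are scalar. -/
lemma exists_eq_smul_of_equivariant (hn : 3 ≤ n) {M : (Fin n → ℂ) →ₗ[ℂ] (Fin n → ℂ)}
    (h : ∀ (A : so (Fin n) ℂ) a, M (A.1 *ᵥ a) = A.1 *ᵥ M a) : ∃ κ : ℂ, ∀ a, M a = κ • a := by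
  obtain ⟨κ, hκ⟩ := exists_eq_smul_dotProduct hn (B := dotProductBilin ℂ ℂ ∘ₗ M) fun A a b => by
    change M (A.1 *ᵥ a) ⬝ᵥ b + M a ⬝ᵥ (A.1 *ᵥ b) = 0
    rw [h, so_dotProduct_mulVec, add_neg_cancel]
  exact ⟨κ, fun a => dotProduct_eq _ _ fun b => by rw [smul_dotProduct, smul_eq_mul]; exact hκ a b⟩

/-- Equivariant bilinear maps from the standard representation of `o(n)` to itself, read as
trilinear forms, are totally antisymmetric. -/
lemma antisymm_of_equivariant (hn : 3 ≤ n) {W : (Fin n → ℂ) →ₗ[ℂ] (Fin n → ℂ) →ₗ[ℂ] (Fin n → ℂ)}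
    (h : ∀ (A : so (Fin n) ℂ) a b, A.1 *ᵥ W a b = W (A.1 *ᵥ a) b + W a (A.1 *ᵥ b)) :
    (∀ a b, W a b = -W b a) ∧ ∀ a b d, W a b ⬝ᵥ d = -(W a d ⬝ᵥ b) := by
  let T (a b d : Fin n) : ℂ := W (Pi.single a 1) (Pi.single b 1) ⬝ᵥ Pi.single d 1
  have hT (i j a b d : Fin n) :
      (if i = a then 1 else 0) * T j b d - (if j = a then 1 else 0) * T i b d +
        ((if i = b then 1 else 0) * T a j d - (if j = b then 1 else 0) * T a i d) +
        ((if i = d then 1 else 0) * T a b j - (if j = d then 1 else 0) * T a b i) = 0 := by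
    have := congrArg (· ⬝ᵥ Pi.single d 1)
      (h (wedge (Pi.single i 1) (Pi.single j 1)) (Pi.single a 1) (Pi.single b 1))
    rw [dotProduct_comm, so_dotProduct_mulVec, dotProduct_comm] at this
    simp only [wedge_single_mulVec_single, map_sub, map_smul, LinearMap.sub_apply,
      LinearMap.smul_apply, sub_dotProduct, dotProduct_sub, add_dotProduct, smul_dotProduct,
      dotProduct_smul, smul_eq_mul] at this
    linear_combination -this
  -- `T` vanishes if an index is repeated: a rotation moves a third index into the repeated pair.
  have h112 (j d : Fin n) : T j j d = 0 ∧ T j d j = 0 ∧ T d j j = 0 := by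
    obtain ⟨i, hj, hd⟩ := exists_ne_ne hn j d
    have hoff (hjd : j ≠ d) : T j j d = 0 ∧ T j d j = 0 ∧ T d j j = 0 := by
      refine ⟨?_, ?_, ?_⟩
      · simpa [hj, hd, hj.symm, hd.symm, hjd, hjd.symm] using hT i d j j i
      · simpa [hj, hd, hj.symm, hd.symm, hjd, hjd.symm] using hT i d j i j
      · simpa [hj, hd, hj.symm, hd.symm, hjd, hjd.symm] using hT i d i j j
    by_cases hjd : j = d
    · subst hjd
      have h1 : T i j i = 0 := by
        obtain ⟨k, hk, hk'⟩ := exists_ne_ne hn i j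
        simpa [hk, hk', hk.symm, hk'.symm, hj, hj.symm] using hT k j i k i
      have h2 : T j i i = 0 := by
        obtain ⟨k, hk, hk'⟩ := exists_ne_ne hn i j
        simpa [hk, hk', hk.symm, hk'.symm, hj, hj.symm] using hT k j k i i
      have h3 : T j j j = 0 := by
        simpa [hj, hj.symm, h1, h2] using hT i j j j i
      exact ⟨h3, h3, h3⟩
    · exact hoff hjd
  have h12 (a b d : Fin n) : T a b d = -T b a d := by
    by_cases hab : a = b
    · subst hab
      rw [(h112 a d).1, neg_zero]
    by_cases had : a = d
    · subst had
      rw [(h112 a b).2.1, (h112 a b).2.2, neg_zero]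
    by_cases hbd : b = d
    · subst hbd
      rw [(h112 b a).2.1, (h112 b a).2.2, neg_zero]
    have := hT a b a a d
    simp [had, hbd, Ne.symm hab] at this
    linear_combination this
  have h23 (a b d : Fin n) : T a b d = -T a d b := by
    by_cases hab : a = b
    · subst hab
      rw [(h112 a d).1, (h112 a d).2.1, neg_zero]
    by_cases had : a = d
    · subst had
      rw [(h112 a b).1, (h112 a b).2.1, neg_zero]
    by_cases hbd : b = d
    · subst hbd
      rw [(h112 b a).2.2, neg_zero]
    have := hT b d a b b
    simp [Ne.symm hab, Ne.symm hbd, Ne.symm had] at this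
    linear_combination this
  have e1 : W = -W.flip := by
    refine (Pi.basisFun ℂ (Fin n)).ext fun a => (Pi.basisFun ℂ (Fin n)).ext fun b => ?_
    rw [Pi.basisFun_apply, Pi.basisFun_apply]
    ext d
    have := h12 a b d
    simp only [T, dotProduct_single, mul_one] at this
    exact this
  have e2 : W.compr₂ (dotProductBilin ℂ ℂ) =
      -(LinearMap.lflip.toLinearMap ∘ₗ W.compr₂ (dotProductBilin ℂ ℂ)) := by
    refine (Pi.basisFun ℂ (Fin n)).ext fun a => (Pi.basisFun ℂ (Fin n)).ext fun b =>
      (Pi.basisFun ℂ (Fin n)).ext fun d => ?_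
    rw [Pi.basisFun_apply, Pi.basisFun_apply, Pi.basisFun_apply]
    exact h23 a b d
  constructor
  · intro a b
    nth_rewrite 1 [e1]
    rfl
  · intro a b d
    exact LinearMap.congr_fun (LinearMap.congr_fun (LinearMap.congr_fun e2 a) b) d

/-- A bilinear map whose partial maps `W a` are skew-symmetric is a linear map to `o(n)`. -/
lemma exists_so_mulVec_eq {W : (Fin n → ℂ) →ₗ[ℂ] (Fin n → ℂ) →ₗ[ℂ] (Fin n → ℂ)}
    (h : ∀ a b d, W a b ⬝ᵥ d = -(W a d ⬝ᵥ b)) :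
    ∃ β : (Fin n → ℂ) →ₗ[ℂ] so (Fin n) ℂ, ∀ a b, (β a).1 *ᵥ b = W a b := by
  let β (a : Fin n → ℂ) : so (Fin n) ℂ := ⟨LinearMap.toMatrix' (W a), by
    rw [mem_so]
    ext i j
    have := h a (Pi.single i 1) (Pi.single j 1)
    simpa [LinearMap.toMatrix'_apply] using this⟩
  refine ⟨⟨⟨β, fun a b => Subtype.ext ?_⟩, fun t a => Subtype.ext ?_⟩, fun a b => ?_⟩
  · change LinearMap.toMatrix' (W (a + b)) = LinearMap.toMatrix' (W a) + LinearMap.toMatrix' (W b)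
    rw [map_add, map_add]
  · change LinearMap.toMatrix' (W (t • a)) = t • LinearMap.toMatrix' (W a)
    rw [map_smul, map_smul]
  · exact LinearMap.toMatrix'_mulVec _ _

lemma so_ext_mulVec {A B : so (Fin n) ℂ} (h : ∀ v, A.1 *ᵥ v = B.1 *ᵥ v) : A = B :=
  Subtype.ext (ext_of_mulVec_single fun _ => h _)

/-- Skew-symmetric matrices `B a` with `B a b = B b a` for all `a, b` vanish, as in the uniqueness
of the Levi-Civita connection. -/
lemma eq_zero_of_symm_of_skew {B : (Fin n → ℂ) → so (Fin n) ℂ}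
    (h : ∀ a b, (B a).1 *ᵥ b = (B b).1 *ᵥ a) (a : Fin n → ℂ) : B a = 0 := by
  have hs (a b d) : (B a).1 *ᵥ b ⬝ᵥ d = -((B a).1 *ᵥ d ⬝ᵥ b) := by
    rw [dotProduct_comm, so_dotProduct_mulVec]
  refine so_ext_mulVec fun b => dotProduct_eq _ _ fun d => ?_
  change _ = (0 : Matrix (Fin n) (Fin n) ℂ) *ᵥ b ⬝ᵥ d
  rw [zero_mulVec, zero_dotProduct]
  have h1 := hs a b d
  have h2 := hs d a b
  have h3 := hs b d a
  rw [h d a, h d b] at h2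
  rw [h b a] at h3
  refine self_eq_neg.1 ?_
  linear_combination h1 - h2 + h3

end Invariants

/-! ### Components of cochains -/

section Components

variable {n : ℕ}

namespace G

lemma ex_lie_x (u : Fin n → ℂ) (w : G ℂ n) : ⁅ex u, w⁆.left.x = -(w.right.1 *ᵥ u) := by
  rw [lie_left_x]
  simp [ex]

lemma ex_lie_p (u : Fin n → ℂ) (w : G ℂ n) : ⁅ex u, w⁆.left.p = 0 := by
  rw [lie_left_p]
  simp [ex]

lemma ex_lie_z (u : Fin n → ℂ) (w : G ℂ n) : ⁅ex u, w⁆.left.z = u ⬝ᵥ w.left.p := by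
  rw [lie_left_z]
  simp [ex]

lemma ep_lie_x (u : Fin n → ℂ) (w : G ℂ n) : ⁅ep u, w⁆.left.x = 0 := by
  rw [lie_left_x]
  simp [ep]

lemma ep_lie_p (u : Fin n → ℂ) (w : G ℂ n) : ⁅ep u, w⁆.left.p = -(w.right.1 *ᵥ u) := by
  rw [lie_left_p]
  simp [ep]

lemma ep_lie_z (u : Fin n → ℂ) (w : G ℂ n) : ⁅ep u, w⁆.left.z = -(w.left.x ⬝ᵥ u) := by
  rw [lie_left_z]
  simp [ep]

lemma rot_lie_x (A : so (Fin n) ℂ) (w : G ℂ n) : ⁅G.rot A, w⁆.left.x = A.1 *ᵥ w.left.x := by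
  rw [lie_left_x]
  simp

lemma rot_lie_p (A : so (Fin n) ℂ) (w : G ℂ n) : ⁅G.rot A, w⁆.left.p = A.1 *ᵥ w.left.p := by
  rw [lie_left_p]
  simp

lemma rot_lie_z (A : so (Fin n) ℂ) (w : G ℂ n) : ⁅G.rot A, w⁆.left.z = 0 := by
  rw [lie_left_z]
  simp

end G

variable {c : twoCochain ℂ (G ℂ n) (G ℂ n)}

/-- A cochain vanishing on `o(n)` is determined by its values on pairs of vectors from
`span(e_1, …, e_n)`, `span(e_{n+1}, …, e_{2n})` and `I`. -/
lemma ext_of_vanishing_on_rot {c' : twoCochain ℂ (G ℂ n) (G ℂ n)}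
    (hR : ∀ (A : so (Fin n) ℂ) y, c (G.rot A) y = 0)
    (hR' : ∀ (A : so (Fin n) ℂ) y, c' (G.rot A) y = 0)
    (hx : ∀ a, c G.I (G.ex a) = c' G.I (G.ex a)) (hp : ∀ a, c G.I (G.ep a) = c' G.I (G.ep a))
    (hxx : ∀ a b, c (G.ex a) (G.ex b) = c' (G.ex a) (G.ex b))
    (hxp : ∀ a b, c (G.ex a) (G.ep b) = c' (G.ex a) (G.ep b))
    (hpp : ∀ a b, c (G.ep a) (G.ep b) = c' (G.ep a) (G.ep b)) : c = c' := by
  have hR2 (y) (A : so (Fin n) ℂ) : c y (G.rot A) = c' y (G.rot A) := by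
    rw [← twoCochain_skew c, ← twoCochain_skew c', hR, hR']
  have hI (y) : c G.I y = c' G.I y := by
    rw [G.decompose y]
    simp only [map_add, map_smul, hx, hp, hR2, twoCochain_alt]
  have hI2 (y) : c y G.I = c' y G.I := by
    rw [← twoCochain_skew c, ← twoCochain_skew c', hI]
  have hpx (a b) : c (G.ep a) (G.ex b) = c' (G.ep a) (G.ex b) := by
    rw [← twoCochain_skew c, ← twoCochain_skew c', hxp]
  refine DFunLike.ext _ _ fun y => LinearMap.ext fun z => ?_
  rw [G.decompose y, G.decompose z]
  simp only [map_add, map_smul, LinearMap.add_apply, LinearMap.smul_apply, hR, hR', hR2, hI, hI2,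
    hxx, hxp, hpx, hpp]

/-- By Cartan's formula a cocycle vanishing on `o(n)` is `o(n)`-invariant. -/
lemma invariantUnder_rot (hc : c ∈ Z2 ℂ (G ℂ n)) (hR : ∀ (A : so (Fin n) ℂ) y, c (G.rot A) y = 0)
    (A : so (Fin n) ℂ) : InvariantUnder (G.rot A) c := by
  intro y z
  have h := twoCocycle_apply_eq hc (G.rot A) y z
  rw [hR, hR, lie_zero, lie_zero, ← twoCochain_skew c (G.rot A) ⁅y, z⁆, hR,
    ← twoCochain_skew c y ⁅G.rot A, z⁆] at h
  rw [← sub_eq_zero, ← h]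
  abel

end Components

/-! ### Values of a cocycle on the centre -/

section CentreComponents

variable {n : ℕ} {c : twoCochain ℂ (G ℂ n) (G ℂ n)}

/-- The cocycle identity for `I` and one vector from each of the two standard representations. -/
lemma ex_lie_apply_I (hc : c ∈ Z2 ℂ (G ℂ n)) (a b : Fin n → ℂ) :
    ⁅G.ex a, c G.I (G.ep b)⁆ = ⁅G.ep b, c G.I (G.ex a)⁆ := by
  have h := twoCocycle_apply_eq hc G.I (G.ex a) (G.ep b)
  rw [G.I_lie, G.I_lie, G.I_lie, G.ex_lie_ep] at h
  simp only [map_zero, LinearMap.zero_apply, map_smul, LinearMap.smul_apply, twoCochain_alt,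
    smul_zero] at h
  rw [← sub_eq_zero, ← neg_eq_zero, ← h]
  abel

/-- A cocycle vanishing on `o(n)` agrees on the centre with a combination of the `f i`. -/
lemma exists_apply_I_eq (hn : 3 ≤ n) (hc : c ∈ Z2 ℂ (G ℂ n))
    (hR : ∀ (A : so (Fin n) ℂ) y, c (G.rot A) y = 0) :
    ∃ ε : Fin 3 → ℂ, (∀ a, c G.I (G.ex a) = ε 0 • G.ep a - ε 2 • G.ex a) ∧
      ∀ a, c G.I (G.ep a) = ε 2 • G.ep a - ε 1 • G.ex a := by
  have heqx (A : so (Fin n) ℂ) (a) : ⁅G.rot A, c G.I (G.ex a)⁆ = c G.I (G.ex (A.1 *ᵥ a)) := by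
    rw [invariantUnder_rot hc hR A, G.lie_I, map_zero, LinearMap.zero_apply, zero_add,
      G.rot_lie_ex]
  have heqp (A : so (Fin n) ℂ) (a) : ⁅G.rot A, c G.I (G.ep a)⁆ = c G.I (G.ep (A.1 *ᵥ a)) := by
    rw [invariantUnder_rot hc hR A, G.lie_I, map_zero, LinearMap.zero_apply, zero_add,
      G.rot_lie_ep]
  have hrx (a) : (c G.I (G.ex a)).right = 0 := by
    refine so_ext_mulVec fun b => ?_
    have h := congrArg (fun w => w.left.p) (ex_lie_apply_I hc a b)
    simp only [G.ex_lie_p, G.ep_lie_p] at h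
    change _ = (0 : Matrix (Fin n) (Fin n) ℂ) *ᵥ b
    rw [zero_mulVec, ← neg_eq_zero, ← h]
  have hrp (b) : (c G.I (G.ep b)).right = 0 := by
    refine so_ext_mulVec fun a => ?_
    have h := congrArg (fun w => w.left.x) (ex_lie_apply_I hc a b)
    simp only [G.ex_lie_x, G.ep_lie_x] at h
    change _ = (0 : Matrix (Fin n) (Fin n) ℂ) *ᵥ a
    rw [zero_mulVec, ← neg_eq_zero, ← h]
  have hz {l : (Fin n → ℂ) →ₗ[ℂ] G ℂ n} (h : ∀ (A : so (Fin n) ℂ) a,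
      ⁅G.rot A, c G.I (l a)⁆ = c G.I (l (A.1 *ᵥ a))) (a) : (c G.I (l a)).left.z = 0 := by
    refine LinearMap.congr_fun (f := G.zL ∘ₗ c G.I ∘ₗ l) (g := 0)
      (invariant_functional_eq_zero hn fun A a => ?_) a
    exact (congrArg (fun w => w.left.z) (h A a)).symm.trans (G.rot_lie_z A _)
  have hx {l : (Fin n → ℂ) →ₗ[ℂ] G ℂ n} (h : ∀ (A : so (Fin n) ℂ) a,
      ⁅G.rot A, c G.I (l a)⁆ = c G.I (l (A.1 *ᵥ a))) :
      ∃ κ : ℂ, ∀ a, (c G.I (l a)).left.x = κ • a :=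
    exists_eq_smul_of_equivariant hn (M := G.xL ∘ₗ c G.I ∘ₗ l) fun A a =>
      (congrArg (fun w => w.left.x) (h A a)).symm.trans (G.rot_lie_x A _)
  have hp {l : (Fin n → ℂ) →ₗ[ℂ] G ℂ n} (h : ∀ (A : so (Fin n) ℂ) a,
      ⁅G.rot A, c G.I (l a)⁆ = c G.I (l (A.1 *ᵥ a))) :
      ∃ κ : ℂ, ∀ a, (c G.I (l a)).left.p = κ • a :=
    exists_eq_smul_of_equivariant hn (M := G.pL ∘ₗ c G.I ∘ₗ l) fun A a =>
      (congrArg (fun w => w.left.p) (h A a)).symm.trans (G.rot_lie_p A _)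
  obtain ⟨κ₁, h₁⟩ := hx heqx
  obtain ⟨κ₂, h₂⟩ := hp heqx
  obtain ⟨κ₃, h₃⟩ := hx heqp
  obtain ⟨κ₄, h₄⟩ := hp heqp
  -- The component along `I` of the cocycle identity makes the matrix of `c(I, ·)` traceless, which
  -- leaves three parameters.
  have h14 : κ₄ = -κ₁ := by
    let i : Fin n := ⟨0, by omega⟩
    have h := congrArg (fun w => w.left.z) (ex_lie_apply_I hc (Pi.single i 1) (Pi.single i 1))
    simp only [G.ex_lie_z, G.ep_lie_z, h₁, h₄] at h
    simpa using h
  refine ⟨![κ₂, -κ₃, -κ₁], fun a => ?_, fun a => ?_⟩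
  · refine G.ext_coords ?_ ?_ ?_ ?_
    · rw [h₁]; simp [G.ex, G.ep]
    · rw [h₂]; simp [G.ex, G.ep]
    · rw [hz heqx]; simp [G.ex, G.ep]
    · rw [hrx]; simp [G.ex, G.ep]
  · refine G.ext_coords ?_ ?_ ?_ ?_
    · rw [h₃]; simp [G.ex, G.ep]
    · rw [h₄, h14]; simp [G.ex, G.ep]
    · rw [hz heqp]; simp [G.ex, G.ep]
    · rw [hrp]; simp [G.ex, G.ep]

end CentreComponents

/-! ### Cocycles that vanish on `o(n)` and on the centre -/

section HeisenbergComponents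

variable {n : ℕ} {c : twoCochain ℂ (G ℂ n) (G ℂ n)}

lemma apply_heisenberg_lie (hI : ∀ y, c G.I y = 0) (a b : Fin n → ℂ) (y : G ℂ n) :
    c ⁅G.ex a, G.ex b⁆ y = 0 ∧ c ⁅G.ex a, G.ep b⁆ y = 0 ∧ c ⁅G.ep a, G.ep b⁆ y = 0 := by
  rw [G.ex_lie_ex, G.ex_lie_ep, G.ep_lie_ep, map_smul, LinearMap.smul_apply, hI, smul_zero,
    map_zero, LinearMap.zero_apply]
  exact ⟨rfl, rfl, rfl⟩

lemma cocycle_xxx (hc : c ∈ Z2 ℂ (G ℂ n)) (hI : ∀ y, c G.I y = 0) (a b d : Fin n → ℂ) :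
    ⁅G.ex a, c (G.ex b) (G.ex d)⁆ - ⁅G.ex b, c (G.ex a) (G.ex d)⁆ +
      ⁅G.ex d, c (G.ex a) (G.ex b)⁆ = 0 := by
  have h := twoCocycle_apply_eq hc (G.ex a) (G.ex b) (G.ex d)
  rwa [(apply_heisenberg_lie hI _ _ _).1, (apply_heisenberg_lie hI _ _ _).1,
    (apply_heisenberg_lie hI _ _ _).1, sub_zero, add_zero, sub_zero] at h

lemma cocycle_xxp (hc : c ∈ Z2 ℂ (G ℂ n)) (hI : ∀ y, c G.I y = 0) (a b d : Fin n → ℂ) :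
    ⁅G.ex a, c (G.ex b) (G.ep d)⁆ - ⁅G.ex b, c (G.ex a) (G.ep d)⁆ +
      ⁅G.ep d, c (G.ex a) (G.ex b)⁆ = 0 := by
  have h := twoCocycle_apply_eq hc (G.ex a) (G.ex b) (G.ep d)
  rwa [(apply_heisenberg_lie hI _ _ _).1, (apply_heisenberg_lie hI _ _ _).2.1,
    (apply_heisenberg_lie hI _ _ _).2.1, sub_zero, add_zero, sub_zero] at h

lemma cocycle_xpp (hc : c ∈ Z2 ℂ (G ℂ n)) (hI : ∀ y, c G.I y = 0) (a b d : Fin n → ℂ) :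
    ⁅G.ex a, c (G.ep b) (G.ep d)⁆ - ⁅G.ep b, c (G.ex a) (G.ep d)⁆ +
      ⁅G.ep d, c (G.ex a) (G.ep b)⁆ = 0 := by
  have h := twoCocycle_apply_eq hc (G.ex a) (G.ep b) (G.ep d)
  rwa [(apply_heisenberg_lie hI _ _ _).2.1, (apply_heisenberg_lie hI _ _ _).2.1,
    (apply_heisenberg_lie hI _ _ _).2.2, sub_zero, add_zero, sub_zero] at h

lemma cocycle_ppp (hc : c ∈ Z2 ℂ (G ℂ n)) (hI : ∀ y, c G.I y = 0) (a b d : Fin n → ℂ) :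
    ⁅G.ep a, c (G.ep b) (G.ep d)⁆ - ⁅G.ep b, c (G.ep a) (G.ep d)⁆ +
      ⁅G.ep d, c (G.ep a) (G.ep b)⁆ = 0 := by
  have h := twoCocycle_apply_eq hc (G.ep a) (G.ep b) (G.ep d)
  rwa [(apply_heisenberg_lie hI _ _ _).2.2, (apply_heisenberg_lie hI _ _ _).2.2,
    (apply_heisenberg_lie hI _ _ _).2.2, sub_zero, add_zero, sub_zero] at h

lemma right_eq_zero_of_mulVec {w : G ℂ n} (h : ∀ v, w.right.1 *ᵥ v = 0) : w.right = 0 := by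
  refine so_ext_mulVec fun v => ?_
  change _ = (0 : Matrix (Fin n) (Fin n) ℂ) *ᵥ v
  rw [zero_mulVec, h]

/-- A cocycle vanishing on `o(n)` and on the centre has no component in `o(n)`. -/
lemma apply_right_eq_zero (hc : c ∈ Z2 ℂ (G ℂ n)) (hI : ∀ y, c G.I y = 0) (a b : Fin n → ℂ) :
    (c (G.ex a) (G.ex b)).right = 0 ∧ (c (G.ex a) (G.ep b)).right = 0 ∧
      (c (G.ep a) (G.ep b)).right = 0 := by
  refine ⟨right_eq_zero_of_mulVec fun d => ?_, ?_, right_eq_zero_of_mulVec fun d => ?_⟩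
  · have h := congrArg (fun w => w.left.p) (cocycle_xxp hc hI a b d)
    simp only [G.add_left, G.sub_left, Heisenberg.add_p, Heisenberg.sub_p, G.ex_lie_p, G.ep_lie_p,
      G.zero_left, Heisenberg.zero_p, sub_zero, zero_add] at h
    exact neg_eq_zero.1 h
  · refine eq_zero_of_symm_of_skew (B := fun a => (c (G.ex a) (G.ep b)).right) (fun a d => ?_) a
    have h := congrArg (fun w => w.left.x) (cocycle_xxp hc hI a d b)
    simp only [G.add_left, G.sub_left, Heisenberg.add_x, Heisenberg.sub_x, G.ex_lie_x, G.ep_lie_x,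
      G.zero_left, Heisenberg.zero_x, add_zero] at h
    rw [← sub_eq_zero, ← h]
    abel
  · have h := congrArg (fun w => w.left.x) (cocycle_xpp hc hI d a b)
    simp only [G.add_left, G.sub_left, Heisenberg.add_x, Heisenberg.sub_x, G.ex_lie_x, G.ep_lie_x,
      G.zero_left, Heisenberg.zero_x, sub_zero, add_zero] at h
    exact neg_eq_zero.1 h

variable (c) in
/-- The component of a cochain given by two inclusions `i, j` and a projection `k`. -/
def component {M : Type*} [AddCommGroup M] [Module ℂ M] (i j : (Fin n → ℂ) →ₗ[ℂ] G ℂ n)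
    (k : G ℂ n →ₗ[ℂ] M) : (Fin n → ℂ) →ₗ[ℂ] (Fin n → ℂ) →ₗ[ℂ] M :=
  (c.1.compl₁₂ i j).compr₂ k

/-- A linear map from the standard representation to `g_n` is `o(n)`-equivariant. -/
def IsEquivariant (i : (Fin n → ℂ) →ₗ[ℂ] G ℂ n) : Prop :=
  ∀ (A : so (Fin n) ℂ) a, ⁅G.rot A, i a⁆ = i (A.1 *ᵥ a)

lemma rot_lie_apply (hc : c ∈ Z2 ℂ (G ℂ n)) (hR : ∀ (A : so (Fin n) ℂ) y, c (G.rot A) y = 0)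
    {i j : (Fin n → ℂ) →ₗ[ℂ] G ℂ n} (hi : IsEquivariant i) (hj : IsEquivariant j)
    (A : so (Fin n) ℂ) (a b : Fin n → ℂ) :
    ⁅G.rot A, c (i a) (j b)⁆ = c (i (A.1 *ᵥ a)) (j b) + c (i a) (j (A.1 *ᵥ b)) := by
  rw [invariantUnder_rot hc hR, hi, hj]

lemma component_x_antisymm (hn : 3 ≤ n) (hc : c ∈ Z2 ℂ (G ℂ n))
    (hR : ∀ (A : so (Fin n) ℂ) y, c (G.rot A) y = 0) {i j : (Fin n → ℂ) →ₗ[ℂ] G ℂ n}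
    (hi : IsEquivariant i) (hj : IsEquivariant j) :
    (∀ a b, (c (i a) (j b)).left.x = -(c (i b) (j a)).left.x) ∧
      ∀ a b d, (c (i a) (j b)).left.x ⬝ᵥ d = -((c (i a) (j d)).left.x ⬝ᵥ b) :=
  antisymm_of_equivariant hn (W := component c i j G.xL) fun A a b =>
    (G.rot_lie_x A _).symm.trans (congrArg (fun w => w.left.x) (rot_lie_apply hc hR hi hj A a b))

lemma component_p_antisymm (hn : 3 ≤ n) (hc : c ∈ Z2 ℂ (G ℂ n))
    (hR : ∀ (A : so (Fin n) ℂ) y, c (G.rot A) y = 0) {i j : (Fin n → ℂ) →ₗ[ℂ] G ℂ n}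
    (hi : IsEquivariant i) (hj : IsEquivariant j) :
    (∀ a b, (c (i a) (j b)).left.p = -(c (i b) (j a)).left.p) ∧
      ∀ a b d, (c (i a) (j b)).left.p ⬝ᵥ d = -((c (i a) (j d)).left.p ⬝ᵥ b) :=
  antisymm_of_equivariant hn (W := component c i j G.pL) fun A a b =>
    (G.rot_lie_p A _).symm.trans (congrArg (fun w => w.left.p) (rot_lie_apply hc hR hi hj A a b))

lemma component_z_eq (hn : 3 ≤ n) (hc : c ∈ Z2 ℂ (G ℂ n))
    (hR : ∀ (A : so (Fin n) ℂ) y, c (G.rot A) y = 0) {i j : (Fin n → ℂ) →ₗ[ℂ] G ℂ n}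
    (hi : IsEquivariant i) (hj : IsEquivariant j) :
    ∃ κ : ℂ, ∀ a b, (c (i a) (j b)).left.z = κ * (a ⬝ᵥ b) :=
  exists_eq_smul_dotProduct hn (B := component c i j G.zL) fun A a b =>
    (congrArg (fun w => w.left.z) (rot_lie_apply hc hR hi hj A a b)).symm.trans (G.rot_lie_z A _)

lemma component_z_eq_zero (hn : 3 ≤ n) (hc : c ∈ Z2 ℂ (G ℂ n))
    (hR : ∀ (A : so (Fin n) ℂ) y, c (G.rot A) y = 0) {i : (Fin n → ℂ) →ₗ[ℂ] G ℂ n}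
    (hi : IsEquivariant i) (a b : Fin n → ℂ) : (c (i a) (i b)).left.z = 0 := by
  obtain ⟨κ, hκ⟩ := component_z_eq hn hc hR hi hi
  have h1 : (c (i b) (i a)).left.z = -(c (i a) (i b)).left.z := by
    rw [← twoCochain_skew c (i a) (i b)]
    rfl
  rw [hκ, hκ, dotProduct_comm] at h1
  rw [hκ]
  exact self_eq_neg.1 h1

/-- Let `c` be a cocycle vanishing on `o(n)` and on the centre. Its components in
`span(e_1, …, e_{2n})` are totally antisymmetric trilinear forms, and the component along `I` of the
cocycle identity expresses them through the values on the mixed pairs `(e_i, e_{n+j})`. -/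
lemma apply_left_eq (hn : 3 ≤ n) (hc : c ∈ Z2 ℂ (G ℂ n))
    (hR : ∀ (A : so (Fin n) ℂ) y, c (G.rot A) y = 0) (hI : ∀ y, c G.I y = 0) (a b : Fin n → ℂ) :
    (c (G.ex a) (G.ex b)).left.x = (2 : ℂ) • (c (G.ex a) (G.ep b)).left.p ∧
      (c (G.ex a) (G.ex b)).left.p = 0 ∧ (c (G.ep a) (G.ep b)).left.x = 0 ∧
      (c (G.ep a) (G.ep b)).left.p = (2 : ℂ) • (c (G.ex a) (G.ep b)).left.x := by
  have hX : IsEquivariant (G.ex : _ →ₗ[ℂ] G ℂ n) := G.rot_lie_ex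
  have hP : IsEquivariant (G.ep : _ →ₗ[ℂ] G ℂ n) := G.rot_lie_ep
  obtain ⟨hq1, hq2⟩ := component_x_antisymm hn hc hR hX hP
  obtain ⟨hp1, hp2⟩ := component_p_antisymm hn hc hR hX hP
  refine ⟨dotProduct_eq _ _ fun d => ?_, dotProduct_eq _ _ fun d => ?_,
    dotProduct_eq _ _ fun d => ?_, dotProduct_eq _ _ fun d => ?_⟩
  · have h := congrArg (fun w => w.left.z) (cocycle_xxp hc hI a b d)
    simp only [G.add_left, G.sub_left, Heisenberg.add_z, Heisenberg.sub_z, G.ex_lie_z, G.ep_lie_z,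
      G.zero_left, Heisenberg.zero_z] at h
    rw [dotProduct_comm a, dotProduct_comm b, hp2 b d a, hp2 a d b, hp1 b a, neg_dotProduct] at h
    rw [smul_dotProduct, smul_eq_mul]
    linear_combination -h
  · obtain ⟨h1, h2⟩ := component_p_antisymm hn hc hR hX hX
    have h := congrArg (fun w => w.left.z) (cocycle_xxx hc hI a b d)
    simp only [G.add_left, G.sub_left, Heisenberg.add_z, Heisenberg.sub_z, G.ex_lie_z,
      G.zero_left, Heisenberg.zero_z] at h
    rw [dotProduct_comm a, dotProduct_comm b, dotProduct_comm d, h2 b d a, h2 a d b, h1 b a,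
      neg_dotProduct] at h
    rw [zero_dotProduct]
    linear_combination h / 3
  · obtain ⟨h1, h2⟩ := component_x_antisymm hn hc hR hP hP
    have h := congrArg (fun w => w.left.z) (cocycle_ppp hc hI a b d)
    simp only [G.add_left, G.sub_left, Heisenberg.add_z, Heisenberg.sub_z, G.ep_lie_z,
      G.zero_left, Heisenberg.zero_z] at h
    rw [h2 b d a, h2 a d b, h1 b a, neg_dotProduct] at h
    rw [zero_dotProduct]
    linear_combination -h / 3
  · have h := congrArg (fun w => w.left.z) (cocycle_xpp hc hI d a b)
    simp only [G.add_left, G.sub_left, Heisenberg.add_z, Heisenberg.sub_z, G.ex_lie_z, G.ep_lie_z,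
      G.zero_left, Heisenberg.zero_z] at h
    rw [dotProduct_comm d, hq1 d b, hq1 d a, neg_dotProduct, neg_dotProduct, hq2 b d a, hq2 a d b,
      hq1 b a, neg_dotProduct] at h
    rw [smul_dotProduct, smul_eq_mul]
    linear_combination h

/-- The linear map `a ↦ rot (β₁ a.x + β₂ a.p) + t a.z I`, a candidate for a 1-cochain with given
coboundary. -/
def primitive (β₁ β₂ : (Fin n → ℂ) →ₗ[ℂ] so (Fin n) ℂ) (t : ℂ) : G ℂ n →ₗ[ℂ] G ℂ n :=
  G.rotL ∘ₗ (β₁ ∘ₗ G.xL + β₂ ∘ₗ G.pL) + t • (LinearMap.toSpanSingleton ℂ _ G.I ∘ₗ G.zL)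

lemma primitive_apply (β₁ β₂ : (Fin n → ℂ) →ₗ[ℂ] so (Fin n) ℂ) (t : ℂ) (a : G ℂ n) :
    primitive β₁ β₂ t a = G.rotL (β₁ a.left.x + β₂ a.left.p) + t • a.left.z • G.I := rfl

lemma primitive_ex (β₁ β₂ : (Fin n → ℂ) →ₗ[ℂ] so (Fin n) ℂ) (t : ℂ) (a : Fin n → ℂ) :
    primitive β₁ β₂ t (G.ex a) = G.rot (β₁ a) := by
  rw [primitive_apply]
  change G.rotL (β₁ a + β₂ 0) + t • (0 : ℂ) • G.I = G.rotL (β₁ a)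
  rw [map_zero, add_zero, zero_smul, smul_zero, add_zero]

lemma primitive_ep (β₁ β₂ : (Fin n → ℂ) →ₗ[ℂ] so (Fin n) ℂ) (t : ℂ) (a : Fin n → ℂ) :
    primitive β₁ β₂ t (G.ep a) = G.rot (β₂ a) := by
  rw [primitive_apply]
  change G.rotL (β₁ 0 + β₂ a) + t • (0 : ℂ) • G.I = G.rotL (β₂ a)
  rw [map_zero, zero_add, zero_smul, smul_zero, add_zero]

lemma primitive_I (β₁ β₂ : (Fin n → ℂ) →ₗ[ℂ] so (Fin n) ℂ) (t : ℂ) :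
    primitive β₁ β₂ t G.I = t • G.I := by
  rw [primitive_apply]
  change G.rotL (β₁ 0 + β₂ 0) + t • (1 : ℂ) • G.I = t • G.I
  rw [map_zero, map_zero, zero_add, one_smul, map_zero, zero_add]

lemma primitive_rot (β₁ β₂ : (Fin n → ℂ) →ₗ[ℂ] so (Fin n) ℂ) (t : ℂ) (A : so (Fin n) ℂ) :
    primitive β₁ β₂ t (G.rot A) = 0 := by
  rw [primitive_apply]
  change G.rotL (β₁ 0 + β₂ 0) + t • (0 : ℂ) • G.I = 0
  rw [map_zero, map_zero, zero_add, zero_smul, map_zero, zero_add, smul_zero]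

lemma lie_rot (a : G ℂ n) (A : so (Fin n) ℂ) : ⁅a, G.rot A⁆ = -⁅(G.rot A : G ℂ n), a⁆ :=
  (lie_skew _ _).symm

lemma coboundaryMap_primitive_ex_ex (β₁ β₂ : (Fin n → ℂ) →ₗ[ℂ] so (Fin n) ℂ) (t : ℂ)
    (a b : Fin n → ℂ) : (coboundaryMap ℂ (G ℂ n) (primitive β₁ β₂ t)).1 (G.ex a) (G.ex b) =
      G.ex ((β₁ a).1 *ᵥ b - (β₁ b).1 *ᵥ a) := by
  rw [coboundaryMap_apply, G.ex_lie_ex, map_zero, primitive_ex, primitive_ex, lie_rot, lie_rot,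
    G.rot_lie_ex, G.rot_lie_ex, map_sub]
  abel

lemma coboundaryMap_primitive_ep_ep (β₁ β₂ : (Fin n → ℂ) →ₗ[ℂ] so (Fin n) ℂ) (t : ℂ)
    (a b : Fin n → ℂ) : (coboundaryMap ℂ (G ℂ n) (primitive β₁ β₂ t)).1 (G.ep a) (G.ep b) =
      G.ep ((β₂ a).1 *ᵥ b - (β₂ b).1 *ᵥ a) := by
  rw [coboundaryMap_apply, G.ep_lie_ep, map_zero, primitive_ep, primitive_ep, lie_rot, lie_rot,
    G.rot_lie_ep, G.rot_lie_ep, map_sub]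
  abel

lemma coboundaryMap_primitive_ex_ep (β₁ β₂ : (Fin n → ℂ) →ₗ[ℂ] so (Fin n) ℂ) (t : ℂ)
    (a b : Fin n → ℂ) : (coboundaryMap ℂ (G ℂ n) (primitive β₁ β₂ t)).1 (G.ex a) (G.ep b) =
      G.ep ((β₁ a).1 *ᵥ b) - G.ex ((β₂ b).1 *ᵥ a) - (a ⬝ᵥ b * t) • G.I := by
  rw [coboundaryMap_apply, G.ex_lie_ep, map_smul, primitive_I, primitive_ex, primitive_ep, lie_rot,
    lie_rot, G.rot_lie_ep, G.rot_lie_ex, smul_smul]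
  abel

lemma coboundaryMap_primitive_I (β₁ β₂ : (Fin n → ℂ) →ₗ[ℂ] so (Fin n) ℂ) (t : ℂ) (y : G ℂ n) :
    (coboundaryMap ℂ (G ℂ n) (primitive β₁ β₂ t)).1 G.I y = 0 := by
  rw [coboundaryMap_apply, primitive_I, lie_smul, G.lie_I, G.I_lie, G.I_lie, map_zero, smul_zero,
    sub_zero, sub_zero]

/-- The coboundary of `primitive β₁ β₂ t` vanishes on `o(n)` if `β₁` and `β₂` are equivariant. -/
lemma coboundaryMap_primitive_rot {β₁ β₂ : (Fin n → ℂ) →ₗ[ℂ] so (Fin n) ℂ} (t : ℂ)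
    (h₁ : ∀ (A : so (Fin n) ℂ) a, β₁ (A.1 *ᵥ a) = ⁅A, β₁ a⁆)
    (h₂ : ∀ (A : so (Fin n) ℂ) a, β₂ (A.1 *ᵥ a) = ⁅A, β₂ a⁆) (A : so (Fin n) ℂ) (y : G ℂ n) :
    (coboundaryMap ℂ (G ℂ n) (primitive β₁ β₂ t)).1 (G.rot A) y = 0 := by
  rw [coboundaryMap_apply, primitive_rot, lie_zero, sub_zero]
  rw [G.decompose y]
  simp only [lie_add, map_add, lie_smul, map_smul, primitive_ex, primitive_ep, primitive_I,
    primitive_rot, G.rot_lie_rot, G.rot_lie_ex, G.rot_lie_ep, G.lie_I, h₁, h₂, lie_zero, map_zero,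
    smul_zero, sub_self]

lemma apply_ex_ex (hn : 3 ≤ n) (hc : c ∈ Z2 ℂ (G ℂ n))
    (hR : ∀ (A : so (Fin n) ℂ) y, c (G.rot A) y = 0) (hI : ∀ y, c G.I y = 0) (a b : Fin n → ℂ) :
    c (G.ex a) (G.ex b) = G.ex ((2 : ℂ) • (c (G.ex a) (G.ep b)).left.p) :=
  G.ext_coords (apply_left_eq hn hc hR hI a b).1 (apply_left_eq hn hc hR hI a b).2.1
    (component_z_eq_zero hn hc hR G.rot_lie_ex a b)
    (congrArg Subtype.val (apply_right_eq_zero hc hI a b).1)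

lemma apply_ep_ep (hn : 3 ≤ n) (hc : c ∈ Z2 ℂ (G ℂ n))
    (hR : ∀ (A : so (Fin n) ℂ) y, c (G.rot A) y = 0) (hI : ∀ y, c G.I y = 0) (a b : Fin n → ℂ) :
    c (G.ep a) (G.ep b) = G.ep ((2 : ℂ) • (c (G.ex a) (G.ep b)).left.x) :=
  G.ext_coords (apply_left_eq hn hc hR hI a b).2.2.1 (apply_left_eq hn hc hR hI a b).2.2.2
    (component_z_eq_zero hn hc hR G.rot_lie_ep a b)
    (congrArg Subtype.val (apply_right_eq_zero hc hI a b).2.2)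

lemma apply_ex_ep (hc : c ∈ Z2 ℂ (G ℂ n)) (hI : ∀ y, c G.I y = 0) (a b : Fin n → ℂ) :
    c (G.ex a) (G.ep b) = G.ex (c (G.ex a) (G.ep b)).left.x + G.ep (c (G.ex a) (G.ep b)).left.p +
      (c (G.ex a) (G.ep b)).left.z • G.I := by
  have h := G.decompose (c (G.ex a) (G.ep b))
  rw [(apply_right_eq_zero hc hI a b).2.1] at h
  exact h.trans (add_zero _)

/-- The values on the mixed pairs `(e_i, e_{n+j})` of a cocycle vanishing on `o(n)`. -/
lemma exists_apply_ex_ep_eq (hn : 3 ≤ n) (hc : c ∈ Z2 ℂ (G ℂ n))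
    (hR : ∀ (A : so (Fin n) ℂ) y, c (G.rot A) y = 0) :
    ∃ (β₁ β₂ : (Fin n → ℂ) →ₗ[ℂ] so (Fin n) ℂ) (κ : ℂ),
      (∀ (A : so (Fin n) ℂ) a, β₁ (A.1 *ᵥ a) = ⁅A, β₁ a⁆) ∧
      (∀ (A : so (Fin n) ℂ) a, β₂ (A.1 *ᵥ a) = ⁅A, β₂ a⁆) ∧
      (∀ a b, (β₁ a).1 *ᵥ b = -((β₁ b).1 *ᵥ a)) ∧ (∀ a b, (β₂ a).1 *ᵥ b = -((β₂ b).1 *ᵥ a)) ∧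
      ∀ a b, (c (G.ex a) (G.ep b)).left.p = (β₁ a).1 *ᵥ b ∧
        (c (G.ex a) (G.ep b)).left.x = (β₂ a).1 *ᵥ b ∧
        (c (G.ex a) (G.ep b)).left.z = κ * (a ⬝ᵥ b) := by
  have hX : IsEquivariant (G.ex : _ →ₗ[ℂ] G ℂ n) := G.rot_lie_ex
  have hP : IsEquivariant (G.ep : _ →ₗ[ℂ] G ℂ n) := G.rot_lie_ep
  obtain ⟨κ, hκ⟩ := component_z_eq hn hc hR hX hP
  obtain ⟨hq1, hq2⟩ := component_x_antisymm hn hc hR hX hP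
  obtain ⟨hp1, hp2⟩ := component_p_antisymm hn hc hR hX hP
  obtain ⟨β₁, hβ₁⟩ := exists_so_mulVec_eq (W := component c G.ex G.ep G.pL) hp2
  obtain ⟨β₂, hβ₂⟩ := exists_so_mulVec_eq (W := component c G.ex G.ep G.xL) hq2
  replace hβ₁ (a b) : (β₁ a).1 *ᵥ b = (c (G.ex a) (G.ep b)).left.p := hβ₁ a b
  replace hβ₂ (a b) : (β₂ a).1 *ᵥ b = (c (G.ex a) (G.ep b)).left.x := hβ₂ a b
  refine ⟨β₁, β₂, κ, fun A a => so_ext_mulVec fun b => ?_, fun A a => so_ext_mulVec fun b => ?_,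
    fun a b => ?_, fun a b => ?_, fun a b => ⟨(hβ₁ a b).symm, (hβ₂ a b).symm, hκ a b⟩⟩
  · have h := congrArg (fun w => w.left.p) (rot_lie_apply hc hR hX hP A a b)
    simp only [G.rot_lie_p, G.add_left, Heisenberg.add_p] at h
    rw [so_lie_mulVec, hβ₁, hβ₁, hβ₁, h, add_sub_cancel_right]
  · have h := congrArg (fun w => w.left.x) (rot_lie_apply hc hR hX hP A a b)
    simp only [G.rot_lie_x, G.add_left, Heisenberg.add_x] at h
    rw [so_lie_mulVec, hβ₂, hβ₂, hβ₂, h, add_sub_cancel_right]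
  · rw [hβ₁, hβ₁, hp1]
  · rw [hβ₂, hβ₂, hq1]

/-- A 2-cocycle of `g_n` vanishing on `o(n)` and on the centre is a coboundary. -/
theorem exists_eq_coboundary (hn : 3 ≤ n) (hc : c ∈ Z2 ℂ (G ℂ n))
    (hR : ∀ (A : so (Fin n) ℂ) y, c (G.rot A) y = 0) (hI : ∀ y, c G.I y = 0) :
    ∃ τ : G ℂ n →ₗ[ℂ] G ℂ n, c = (coboundaryMap ℂ (G ℂ n) τ).1 := by
  have key := exists_apply_ex_ep_eq hn hc hR
  obtain ⟨β₁, β₂, κ, heq₁, heq₂, hs₁, hs₂, h⟩ := key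
  refine ⟨primitive β₁ β₂ (-κ), ?_⟩
  have hxx := apply_ex_ex hn hc hR hI
  have hpp := apply_ep_ep hn hc hR hI
  have hxp := apply_ex_ep hc hI
  clear hc
  refine ext_of_vanishing_on_rot hR (coboundaryMap_primitive_rot _ heq₁ heq₂) (fun a => ?_)
    (fun a => ?_) (fun a b => ?_) (fun a b => ?_) (fun a b => ?_)
  · exact (hI _).trans (coboundaryMap_primitive_I β₁ β₂ (-κ) _).symm
  · exact (hI _).trans (coboundaryMap_primitive_I β₁ β₂ (-κ) _).symm
  · refine ((hxx a b).trans ?_).trans (coboundaryMap_primitive_ex_ex β₁ β₂ (-κ) a b).symm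
    rw [(h a b).1, hs₁ b a, sub_neg_eq_add, two_smul]
  · refine ((hxp a b).trans ?_).trans (coboundaryMap_primitive_ex_ep β₁ β₂ (-κ) a b).symm
    rw [(h a b).1, (h a b).2.1, (h a b).2.2, hs₂ b a, map_neg]
    module
  · refine ((hpp a b).trans ?_).trans (coboundaryMap_primitive_ep_ep β₁ β₂ (-κ) a b).symm
    rw [(h a b).2.1, hs₂ b a, sub_neg_eq_add, two_smul]

end HeisenbergComponents

/-! ### The second cohomology and the formal deformations of `g_n` -/

section Classification

variable {n : ℕ}

lemma sub_cocycle_apply {R L : Type*} [CommRing R] [LieRing L] [LieAlgebra R L] (c c' : Z2 R L)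
    (y z : L) : (c - c').1 y z = c.1 y z - c'.1 y z := rfl

lemma eq_add_of_eq_add_of_sub_val_eq {R L : Type*} [CommRing R] [LieRing L] [LieAlgebra R L]
    {c c₀ s : Z2 R L} {τ₀ τ : L →ₗ[R] L} (h : c = c₀ + coboundaryMap R L τ₀)
    (h' : (c₀ - s).1 = (coboundaryMap R L τ).1) : c = s + coboundaryMap R L (τ + τ₀) := by
  rw [h, map_add, ← sub_add_cancel c₀ s, Subtype.ext h']
  abel

lemma apply_I_eq_zero {c : twoCochain ℂ (G ℂ n) (G ℂ n)}
    (hR : ∀ (A : so (Fin n) ℂ) y, c (G.rot A) y = 0) (hx : ∀ a, c G.I (G.ex a) = 0)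
    (hp : ∀ a, c G.I (G.ep a) = 0) (y : G ℂ n) : c G.I y = 0 := by
  have hr (A : so (Fin n) ℂ) : c G.I (G.rot A) = 0 := by
    rw [← twoCochain_skew, hR, neg_zero]
  rw [G.decompose y, map_add, map_add, map_add, map_smul, twoCochain_alt, hr, hx, hp, smul_zero,
    add_zero, add_zero, add_zero]

/-- Two cocycles that vanish on `o(n)` and agree on the centre are cohomologous. -/
lemma exists_sub_eq_coboundary (hn : 3 ≤ n) (c s : Z2 ℂ (G ℂ n))
    (hR : ∀ (A : so (Fin n) ℂ) y, c.1 (G.rot A) y = 0)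
    (hR' : ∀ (A : so (Fin n) ℂ) y, s.1 (G.rot A) y = 0)
    (hx : ∀ a, c.1 G.I (G.ex a) = s.1 G.I (G.ex a))
    (hp : ∀ a, c.1 G.I (G.ep a) = s.1 G.I (G.ep a)) :
    ∃ τ : G ℂ n →ₗ[ℂ] G ℂ n, (c - s).1 = (coboundaryMap ℂ (G ℂ n) τ).1 := by
  have h1 (A : so (Fin n) ℂ) (y) : (c - s).1 (G.rot A) y = 0 :=
    (sub_cocycle_apply c s _ _).trans (sub_eq_zero.2 ((hR A y).trans (hR' A y).symm))
  have h2 := apply_I_eq_zero h1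
    (fun a => (sub_cocycle_apply c s _ _).trans (sub_eq_zero.2 (hx a)))
    (fun a => (sub_cocycle_apply c s _ _).trans (sub_eq_zero.2 (hp a)))
  exact exists_eq_coboundary hn (c - s).2 h1 h2

/-- A cocycle vanishing on `o(n)` is a combination of the `f i` up to a coboundary. -/
lemma exists_sub_sum_eq_coboundary (hn : 3 ≤ n) (c : Z2 ℂ (G ℂ n))
    (hR : ∀ (A : so (Fin n) ℂ) y, c.1 (G.rot A) y = 0) :
    ∃ (ε : Fin 3 → ℂ) (τ : G ℂ n →ₗ[ℂ] G ℂ n),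
      (c - ∑ i, ε i • fCocycle n i).1 = (coboundaryMap ℂ (G ℂ n) τ).1 := by
  have key := exists_apply_I_eq hn c.2 hR
  obtain ⟨ε, hx, hp⟩ := key
  exact ⟨ε, exists_sub_eq_coboundary hn c _ hR (sum_f_rot ε)
    (fun a => (hx a).trans (sum_f_I_ex ε a).symm) (fun a => (hp a).trans (sum_f_I_ep ε a).symm)⟩

/-- Every 2-cocycle of `g_n` is a combination of `f₁, f₂, f₃` up to a coboundary. -/
theorem exists_eq_sum_add_coboundary (hn : 3 ≤ n) (c : Z2 ℂ (G ℂ n)) :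
    ∃ (ε : Fin 3 → ℂ) (τ : G ℂ n →ₗ[ℂ] G ℂ n),
      c = ∑ i, ε i • fCocycle n i + coboundaryMap ℂ (G ℂ n) τ := by
  have key := exists_cocycle_vanishing_on_rot hn c
  obtain ⟨c₀, τ₀, hR, hc⟩ := key
  have key := exists_sub_sum_eq_coboundary hn c₀ hR
  clear hR
  obtain ⟨ε, τ, h⟩ := key
  exact ⟨ε, τ + τ₀, eq_add_of_eq_add_of_sub_val_eq hc h⟩

/-- Classes of cocycles that are independent modulo coboundaries and span the cocycles modulo
coboundaries form a basis of the second cohomology. -/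
lemma exists_basis_H2 {K L : Type*} [Field K] [LieRing L] [LieAlgebra K L] (g : Fin 3 → Z2 K L)
    (hli : ∀ (ε : Fin 3 → K) τ, ∑ i, ε i • g i = coboundaryMap K L τ → ε = 0)
    (hsp : ∀ c : Z2 K L, ∃ (ε : Fin 3 → K) (τ : L →ₗ[K] L),
      c = ∑ i, ε i • g i + coboundaryMap K L τ) :
    ∃ b : Module.Basis (Fin 3) K (H2 K L), ∀ i, b i = H2.mk K L (g i) := by
  have h1 : LinearIndependent K fun i => H2.mk K L (g i) := by
    rw [Fintype.linearIndependent_iff]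
    intro ε h
    have h' : H2.mk K L (∑ i, ε i • g i) = 0 := by
      rw [map_sum, ← h]
      exact Finset.sum_congr rfl fun i _ => map_smul _ _ _
    obtain ⟨τ, hτ⟩ := (Submodule.Quotient.mk_eq_zero _).1 h'
    exact congrFun (hli ε τ hτ.symm)
  have h2 : ⊤ ≤ Submodule.span K (Set.range fun i => H2.mk K L (g i)) := by
    rintro x -
    obtain ⟨c, rfl⟩ := Submodule.mkQ_surjective _ x
    obtain ⟨ε, τ, h⟩ := hsp c
    have h0 : H2.mk K L (coboundaryMap K L τ) = 0 :=
      (Submodule.Quotient.mk_eq_zero _).2 ⟨τ, rfl⟩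
    have h' : H2.mk K L c = ∑ i, ε i • H2.mk K L (g i) := by
      rw [h, map_add, h0, add_zero, map_sum]
      exact Finset.sum_congr rfl fun i _ => map_smul _ _ _
    change H2.mk K L c ∈ _
    rw [h']
    exact Submodule.sum_mem _ fun i _ => Submodule.smul_mem _ _ (Submodule.subset_span ⟨i, rfl⟩)
  exact ⟨Module.Basis.mk h1 h2, fun i => Module.Basis.mk_apply h1 h2 i⟩

lemma val_eq_of_eq_add {R L : Type*} [CommRing R] [LieRing L] [LieAlgebra R L]
    {c s : Z2 R L} {τ : L →ₗ[R] L} (h : c = s + coboundaryMap R L τ) :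
    c.1 = s.1 + d₁₂ R L L τ := by
  rw [h]
  rfl

/-- Every 2-cocycle is the linear term of a formal deformation equivalent to a linear family
`[·,·] + t ∑ i, ε i • f i`. -/
theorem exists_formalDeformation_of_mem (hn : 3 ≤ n) (c : Z2 ℂ (G ℂ n)) :
    ∃ (ε : Fin 3 → ℂ) (φ : ℕ → twoCochain ℂ (G ℂ n) (G ℂ n)),
      IsFormalDeformation φ ∧ φ 1 = c.1 ∧ FormallyEquivalent φ (deformedFamily n ε) := by
  have key := exists_eq_sum_add_coboundary hn c
  obtain ⟨ε, τ, h⟩ := key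
  replace h := val_eq_of_eq_add h
  rw [sum_fCocycle_val] at h
  have key := exists_formalDeformation (deformedFamily n ε) (isFormalDeformation_deformedFamily ε) τ
  obtain ⟨φ, h1, h2, h3⟩ := key
  exact ⟨ε, φ, h1, h2.trans h.symm, h3⟩

end Classification

end HeisDef

theorem theorem1p1 (n : ℕ) (hn : 3 ≤ n) :
    -- `H²(g_n, g_n)` is three-dimensional, with basis the classes of the cocycles `f₁, f₂, f₃`
    Module.finrank ℂ (H2 ℂ (G ℂ n)) = 3 ∧
    (∃ b : Module.Basis (Fin 3) ℂ (H2 ℂ (G ℂ n)),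
      ∀ i, ∃ h : f ℂ n i ∈ twoCocycle ℂ (G ℂ n) (G ℂ n), b i = H2.mk ℂ (G ℂ n) ⟨f ℂ n i, h⟩) ∧
    -- every infinitesimal deformation is the first order term of a formal deformation, which can be
    -- taken equivalent to `t ↦ g_n(tε)` for some `ε`
    (∀ c ∈ twoCocycle ℂ (G ℂ n) (G ℂ n), ∃ (ε : Fin 3 → ℂ) (φ : ℕ → twoCochain ℂ (G ℂ n) (G ℂ n)),
      IsFormalDeformation φ ∧ φ 1 = c ∧ FormallyEquivalent φ (deformedFamily n ε)) ∧
    -- every `g_n(ε)` is a Lie algebra, generically isomorphic to `o(n+2)`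
    (∃ h : ∀ ε : Fin 3 → ℂ, Jacobi (deformedBracket n ε),
      ∀ ε : Fin 3 → ℂ, ε 0 ≠ 0 → ε 1 ≠ 0 → ε 2 ^ 2 ≠ ε 0 * ε 1 →
        Nonempty (WithBracket (deformedBracket n ε) (h ε) ≃ₗ⁅ℂ⁆ so (Fin (n + 2)) ℂ)) := by
  have key := exists_basis_H2 (fCocycle n) (fun _ _ => eq_zero_of_sum_eq_coboundary hn)
    (exists_eq_sum_add_coboundary hn)
  refine ⟨?_, ?_, fun c hc => exists_formalDeformation_of_mem hn ⟨c, hc⟩,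
    jacobi_deformedBracket, fun ε h0 _ h2 => nonempty_lieEquiv_so_complex ε _ h0 h2⟩
  · obtain ⟨b, -⟩ := key
    rw [Module.finrank_eq_card_basis b, Fintype.card_fin]
  · obtain ⟨b, hb⟩ := key
    exact ⟨b, fun i => ⟨f_mem i, hb i⟩⟩
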